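/- Let $d$ be a dimension and let $\mathbb H^d=\mathbb R^d\times\mathbb R^d\times\mathbb R$ be the Heisenberg group with group law $(p,q,t)(p',q',t')=(p+p',q+q',t+t'+p\cdot q')$ and Lebesgue (Haar) measure, and let $L_g\psi(x)=\psi(g^{-1}x)$ be left translation on $L^2(\mathbb H^d)$. For $\lambda\neq0$ let $\Pi_\lambda$ be the Schrödinger representation on $L^2(\mathbb R^d)$, $$\Pi_\lambda(p,q,t)f(y)=e^{2\pi i\lambda t}e^{-2\pi i\lambda q\cdot y}f(y-p),$$ and let $\mathcal F\varphi(\lambda)=\int_{\mathbb H^d}\varphi(x)\Pi_\lambda(x)\,dx$ be the operator-valued Fourier transform, defined for $\varphi\in L^1\cap L^2(\mathbb H^d)$ and extended by continuity from $L^2(\mathbb H^d)$ to the Hilbert–Schmidt operator fields that are square integrable with respect to the Plancherel measure $|\lambda|^d\,d\lambda$. For $\varphi,\psi\in L^2(\mathbb H^d)$ and $\alpha\in(0,1]$ put $$[\varphi,\psi](\alpha)=\sum_{j\in\mathbb Z}\big\langle\mathcal F\varphi(\alpha+j),\mathcal F\psi(\alpha+j)\big\rangle_{\mathcal{HS}}\,|\alpha+j|^d,\qquad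 E_\psi=\{\alpha\in(0,1]:[\psi,\psi](\alpha)>0\},$$ where $\langle S,T\rangle_{\mathcal{HS}}=\operatorname{trace}(ST^\dagger)$; these are defined up to null sets. Let $\mathbb A,\mathbb B\in GL(d,\mathbb R)$ be such that $\mathbb A^t\mathbb B$ has integer entries, let $\Gamma_1=\mathbb A\mathbb Z^d\times\mathbb B\mathbb Z^d$ (identified with the set of elements $(p,q,0)$, $(p,q)\in\Gamma_1$, of $\mathbb H^d$), and let $\Gamma$ be the subgroup $\mathbb A\mathbb Z^d\times\mathbb B\mathbb Z^d\times\mathbb Z$ of $\mathbb H^d$. **Theorem.** Let $\psi\in L^2(\mathbb H^d)$, $\psi\neq0$, and assume that for every $\gamma_1\in\Gamma_1\setminus\{0\}$ $$[\psi,L_{\gamma_1}\psi](\alpha)=0\quad\text{for a.e. }\alpha\in E_\psi .$$ Then for $0<A\le B<\infty$ the following are equivalent: a) $\{L_\gamma\psi\}_{\gamma\in\Gamma}$ is a frame with constants $A$ and $B$ for the closed linear span $\langle\psi\rangle_{\Gamma,L}=\overline{\operatorname{span}}\{L_\gamma\psi:\gamma\in\Gamma\}$, that is, $$A\|\varphi\|^2\le\sum_{\gamma\in\Gamma}|\langle\varphi,L_\gamma\psi\rangle|^2\le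 B\|\varphi\|^2\quad\text{for all }\varphi\in\langle\psi\rangle_{\Gamma,L};$$ b) $A\le[\psi,\psi](\alpha)\le B$ for a.e. $\alpha\in E_\psi$. -/

import Mathlib

open MeasureTheory Filter Topology
open scoped ENNReal Matrix

noncomputable section

/-- The (polarized) Heisenberg group `ℍ^d = ℝ^d × ℝ^d × ℝ`, with elements `(p, q, t)`. -/
def Heis (d : ℕ) : Type :=
  EuclideanSpace ℝ (Fin d) × EuclideanSpace ℝ (Fin d) × ℝ

namespace Heis

variable {d : ℕ}

instance : TopologicalSpace (Heis d) :=
  inferInstanceAs (TopologicalSpace (EuclideanSpace ℝ (Fin d) × EuclideanSpace ℝ (Fin d) × ℝ))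

/-- The measure on `ℍ^d` is the Lebesgue measure of `ℝ^d × ℝ^d × ℝ`, which is its Haar measure. -/
instance : MeasureSpace (Heis d) :=
  inferInstanceAs (MeasureSpace (EuclideanSpace ℝ (Fin d) × EuclideanSpace ℝ (Fin d) × ℝ))

instance : BorelSpace (Heis d) :=
  inferInstanceAs (BorelSpace (EuclideanSpace ℝ (Fin d) × EuclideanSpace ℝ (Fin d) × ℝ))

instance : SecondCountableTopology (Heis d) :=
  inferInstanceAs
    (SecondCountableTopology (EuclideanSpace ℝ (Fin d) × EuclideanSpace ℝ (Fin d) × ℝ))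

instance : SigmaFinite (volume : Measure (Heis d)) :=
  inferInstanceAs (SigmaFinite
    (volume : Measure (EuclideanSpace ℝ (Fin d) × EuclideanSpace ℝ (Fin d) × ℝ)))

/-- The element `(p, q, t)`. -/
def mk (p q : EuclideanSpace ℝ (Fin d)) (t : ℝ) : Heis d := (p, q, t)

/-- The coordinate `p` of `(p, q, t)`. -/
def p (x : Heis d) : EuclideanSpace ℝ (Fin d) := x.1

/-- The coordinate `q` of `(p, q, t)`. -/
def q (x : Heis d) : EuclideanSpace ℝ (Fin d) := x.2.1

/-- The coordinate `t` of `(p, q, t)`. -/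
def t (x : Heis d) : ℝ := x.2.2

@[simp] theorem mk_p (a b : EuclideanSpace ℝ (Fin d)) (s : ℝ) : (mk a b s).p = a := rfl
@[simp] theorem mk_q (a b : EuclideanSpace ℝ (Fin d)) (s : ℝ) : (mk a b s).q = b := rfl
@[simp] theorem mk_t (a b : EuclideanSpace ℝ (Fin d)) (s : ℝ) : (mk a b s).t = s := rfl

theorem ext' {x y : Heis d} (hp : x.p = y.p) (hq : x.q = y.q) (ht : x.t = y.t) : x = y :=
  Prod.ext hp (Prod.ext hq ht)

/-- The group law `(p, q, t) (p', q', t') = (p + p', q + q', t + t' + p · q')`. -/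
instance : Mul (Heis d) :=
  ⟨fun x y => mk (x.p + y.p) (x.q + y.q) (x.t + y.t + inner ℝ x.p y.q)⟩

instance : One (Heis d) := ⟨mk 0 0 0⟩

instance : Inv (Heis d) := ⟨fun x => mk (-x.p) (-x.q) (-x.t + inner ℝ x.p x.q)⟩

theorem mul_def (x y : Heis d) :
    x * y = mk (x.p + y.p) (x.q + y.q) (x.t + y.t + inner ℝ x.p y.q) := rfl

theorem one_def : (1 : Heis d) = mk 0 0 0 := rfl

theorem inv_def (x : Heis d) : x⁻¹ = mk (-x.p) (-x.q) (-x.t + inner ℝ x.p x.q) := rfl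

instance : Group (Heis d) :=
  Group.ofLeftAxioms
    (fun x y z => by
      apply ext' <;> simp only [mul_def, mk_p, mk_q, mk_t, inner_add_left, inner_add_right]
      · abel
      · abel
      · ring)
    (fun x => by apply ext' <;> simp [mul_def, one_def])
    (fun x => by apply ext' <;> simp [mul_def, one_def, inv_def])

theorem measurePreserving_mul_left (g : Heis d) :
    MeasurePreserving (fun x : Heis d => g * x) volume volume := by
  have h3 : MeasurePreserving
      (fun x : EuclideanSpace ℝ (Fin d) × ℝ => (g.q + x.1, g.t + x.2 + inner ℝ g.p x.1))
      volume volume := by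
    refine (measurePreserving_add_left volume g.q).skew_product
      (g := fun (a : EuclideanSpace ℝ (Fin d)) (s : ℝ) => g.t + s + inner ℝ g.p a) ?_ ?_
    · fun_prop
    · refine Eventually.of_forall fun a => ?_
      have : (fun s : ℝ => g.t + s + inner ℝ g.p a) = fun s => (g.t + inner ℝ g.p a) + s := by
        funext s; ring
      rw [this]
      exact (measurePreserving_add_left volume (g.t + inner ℝ g.p a)).map_eq
  exact (measurePreserving_add_left volume g.p).prod h3

end Heis

/-- `L²(ℍ^d)`. -/
abbrev L2Heis (d : ℕ) : Type := Lp ℂ 2 (volume : Measure (Heis d))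

/-- `L²(ℝ^d)`. -/
abbrev L2Euc (d : ℕ) : Type := Lp ℂ 2 (volume : Measure (EuclideanSpace ℝ (Fin d)))

/-- Left translation `L_g ψ (x) = ψ (g⁻¹ x)` on `L²(ℍ^d)`. -/
def leftTranslation {d : ℕ} (g : Heis d) : L2Heis d →ₗᵢ[ℂ] L2Heis d :=
  Lp.compMeasurePreservingₗᵢ ℂ (fun x : Heis d => g⁻¹ * x) (Heis.measurePreserving_mul_left g⁻¹)

section Schroedinger

variable {d : ℕ}

/-- The function `y ↦ e^{-2πi ω·y}`. -/
def charE (ω y : EuclideanSpace ℝ (Fin d)) : ℂ :=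
  Complex.exp (((-2 * Real.pi * inner ℝ ω y : ℝ) : ℂ) * Complex.I)

theorem norm_charE (ω y : EuclideanSpace ℝ (Fin d)) : ‖charE ω y‖ = 1 :=
  Complex.norm_exp_ofReal_mul_I _

theorem continuous_charE_right (ω : EuclideanSpace ℝ (Fin d)) : Continuous (charE ω) := by
  unfold charE; fun_prop

theorem continuous_charE_left (y : EuclideanSpace ℝ (Fin d)) :
    Continuous fun ω => charE ω y := by
  unfold charE; fun_prop

theorem memLp_charE_mul (ω : EuclideanSpace ℝ (Fin d)) (f : L2Euc d) :
    MemLp (fun y => charE ω y * f y) 2 volume := by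
  refine (Lp.memLp f).of_le
    ((continuous_charE_right ω).aestronglyMeasurable.mul (Lp.memLp f).1) ?_
  exact Eventually.of_forall fun y => by rw [norm_mul, norm_charE, one_mul]

/-- Modulation `M_ω f (y) = e^{-2πi ω·y} f(y)` on `L²(ℝ^d)`. -/
def modulation (ω : EuclideanSpace ℝ (Fin d)) : L2Euc d →ₗᵢ[ℂ] L2Euc d where
  toFun f := (memLp_charE_mul ω f).toLp _
  map_add' f g := by
    apply Lp.ext
    filter_upwards [(memLp_charE_mul ω (f + g)).coeFn_toLp, (memLp_charE_mul ω f).coeFn_toLp,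
      (memLp_charE_mul ω g).coeFn_toLp, Lp.coeFn_add f g,
      Lp.coeFn_add ((memLp_charE_mul ω f).toLp _) ((memLp_charE_mul ω g).toLp _)]
      with y h1 h2 h3 h4 h5
    rw [h1, h5, Pi.add_apply, h2, h3, h4, Pi.add_apply, mul_add]
  map_smul' c f := by
    apply Lp.ext
    filter_upwards [(memLp_charE_mul ω (c • f)).coeFn_toLp, (memLp_charE_mul ω f).coeFn_toLp,
      Lp.coeFn_smul c f, Lp.coeFn_smul c ((memLp_charE_mul ω f).toLp _)] with y h1 h2 h3 h4
    rw [RingHom.id_apply, h1, h4, Pi.smul_apply, h2, h3, Pi.smul_apply, smul_eq_mul, smul_eq_mul]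
    ring
  norm_map' f := by
    change ‖(memLp_charE_mul ω f).toLp _‖ = ‖f‖
    rw [Lp.norm_toLp, Lp.norm_def]
    congr 1
    exact eLpNorm_congr_norm_ae
      (Eventually.of_forall fun y => by rw [norm_mul, norm_charE, one_mul])

theorem coeFn_modulation (ω : EuclideanSpace ℝ (Fin d)) (f : L2Euc d) :
    modulation ω f =ᵐ[volume] fun y => charE ω y * f y :=
  (memLp_charE_mul ω f).coeFn_toLp

/-- Translation `T_a f (y) = f(y - a)` on `L²(ℝ^d)`. -/
def translation (a : EuclideanSpace ℝ (Fin d)) : L2Euc d →ₗᵢ[ℂ] L2Euc d :=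
  Lp.compMeasurePreservingₗᵢ ℂ (fun y => y - a) (measurePreserving_sub_right volume a)

/-- The Schrödinger representation
`Π_l(p, q, t) f (y) = e^{2πi l t} e^{-2πi l q·y} f(y - p)` on `L²(ℝ^d)`. -/
def schroedinger (l : ℝ) (x : Heis d) : L2Euc d →L[ℂ] L2Euc d :=
  Complex.exp (((2 * Real.pi * l * x.t : ℝ) : ℂ) * Complex.I) •
    ((modulation (l • x.q)).comp (translation x.p)).toContinuousLinearMap

theorem schroedinger_apply (l : ℝ) (x : Heis d) (f : L2Euc d) :
    schroedinger l x f = Complex.exp (((2 * Real.pi * l * x.t : ℝ) : ℂ) * Complex.I) •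
      modulation (l • x.q) (translation x.p f) := rfl

theorem norm_schroedinger_apply (l : ℝ) (x : Heis d) (f : L2Euc d) :
    ‖schroedinger l x f‖ = ‖f‖ := by
  rw [schroedinger_apply, norm_smul, Complex.norm_exp_ofReal_mul_I, one_mul,
    LinearIsometry.norm_map, LinearIsometry.norm_map]

theorem continuous_modulation (f : L2Euc d) :
    Continuous fun ω : EuclideanSpace ℝ (Fin d) => modulation ω f := by
  have hint : Integrable (fun y => ‖f y‖ ^ 2) volume := (Lp.memLp f).integrable_norm_pow (by simp)
  have hinner : ∀ ω₀ ω : EuclideanSpace ℝ (Fin d),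
      inner ℂ (modulation ω₀ f) (modulation ω f)
        = ∫ y, inner ℂ (charE ω₀ y * f y) (charE ω y * f y) := by
    intro ω₀ ω
    rw [L2.inner_def]
    refine integral_congr_ae ?_
    filter_upwards [coeFn_modulation ω₀ f, coeFn_modulation ω f] with y h1 h2
    rw [h1, h2]
  refine continuous_iff_continuousAt.2 fun ω₀ => ?_
  have hc : Continuous fun ω => inner ℂ (modulation ω₀ f) (modulation ω f) := by
    simp_rw [hinner ω₀]
    refine continuous_of_dominated (bound := fun y => ‖f y‖ ^ 2) ?_ ?_ hint ?_
    · intro ω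
      exact ((continuous_charE_right ω₀).aestronglyMeasurable.mul (Lp.memLp f).1).inner
        ((continuous_charE_right ω).aestronglyMeasurable.mul (Lp.memLp f).1)
    · intro ω
      refine Eventually.of_forall fun y => (norm_inner_le_norm _ _).trans (le_of_eq ?_)
      rw [norm_mul, norm_mul, norm_charE, norm_charE]; ring
    · refine Eventually.of_forall fun y => ?_
      exact Continuous.inner continuous_const ((continuous_charE_left y).mul continuous_const)
  have hsq : ∀ ω, ‖modulation ω₀ f - modulation ω f‖ ^ 2
      = 2 * ‖f‖ ^ 2 - 2 * (inner ℂ (modulation ω₀ f) (modulation ω f)).re := by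
    intro ω
    rw [@norm_sub_sq ℂ, LinearIsometry.norm_map, LinearIsometry.norm_map]
    simp only [RCLike.re_to_complex]
    ring
  have hlim : Tendsto (fun ω => ‖modulation ω₀ f - modulation ω f‖ ^ 2) (𝓝 ω₀) (𝓝 0) := by
    have h0 : ‖modulation ω₀ f - modulation ω₀ f‖ ^ 2 = 0 := by simp
    have hcont : Continuous fun ω => ‖modulation ω₀ f - modulation ω f‖ ^ 2 := by
      simp_rw [hsq]
      exact continuous_const.sub (continuous_const.mul (Complex.continuous_re.comp hc))
    have h := hcont.tendsto ω₀
    rwa [h0] at h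
  rw [ContinuousAt, tendsto_iff_norm_sub_tendsto_zero]
  have h := (Real.continuous_sqrt.tendsto 0).comp hlim
  rw [Real.sqrt_zero] at h
  refine h.congr fun ω => ?_
  rw [Function.comp_apply, Real.sqrt_sq (norm_nonneg _), norm_sub_rev]

theorem continuous_translation (f : L2Euc d) :
    Continuous fun a : EuclideanSpace ℝ (Fin d) => translation a f := by
  have hg : Continuous fun a : EuclideanSpace ℝ (Fin d) =>
      (⟨fun y => y - a, by fun_prop⟩ :
        C(EuclideanSpace ℝ (Fin d), EuclideanSpace ℝ (Fin d))) :=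
    ContinuousMap.continuous_of_continuous_uncurry _ (by
      change Continuous fun z : EuclideanSpace ℝ (Fin d) × EuclideanSpace ℝ (Fin d) => z.2 - z.1
      fun_prop)
  exact (continuous_const (y := f)).compMeasurePreservingLp hg
    (fun a => measurePreserving_sub_right volume a) (by simp)

theorem continuous_modulation_joint :
    Continuous fun z : EuclideanSpace ℝ (Fin d) × L2Euc d => modulation z.1 z.2 :=
  continuous_prod_of_continuous_lipschitzWith' _ 1 (fun ω => (modulation ω).lipschitz)
    continuous_modulation

theorem continuous_schroedinger (l : ℝ) (f : L2Euc d) :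
    Continuous fun x : Heis d => schroedinger l x f := by
  have hp : Continuous (Heis.p : Heis d → _) := continuous_fst
  have hq : Continuous (Heis.q : Heis d → _) := continuous_fst.comp continuous_snd
  have ht : Continuous (Heis.t : Heis d → ℝ) := continuous_snd.comp continuous_snd
  simp_rw [schroedinger_apply]
  have he : Continuous fun x : Heis d =>
      Complex.exp (((2 * Real.pi * l * x.t : ℝ) : ℂ) * Complex.I) :=
    Complex.continuous_exp.comp
      ((Complex.continuous_ofReal.comp (continuous_const.mul ht)).mul continuous_const)
  have hlq : Continuous fun x : Heis d => l • x.q :=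
    (continuous_const_smul l).comp hq
  have htr : Continuous fun x : Heis d => translation x.p f :=
    (continuous_translation f).comp hp
  have hpair : Continuous fun x : Heis d => (l • x.q, translation x.p f) := hlq.prodMk htr
  have hm := continuous_modulation_joint.comp hpair
  simp only [Function.comp_def] at hm
  have h := he.smul hm
  simpa only [Pi.smul_def'] using h

theorem integrable_smul_schroedinger {φ : Heis d → ℂ} (hφ : Integrable φ) (l : ℝ) (f : L2Euc d) :
    Integrable fun x => φ x • schroedinger l x f := by
  refine (hφ.norm.mul_const ‖f‖).mono'
    (hφ.1.smul (continuous_schroedinger l f).aestronglyMeasurable) ?_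
  exact Eventually.of_forall fun x => by rw [norm_smul, norm_schroedinger_apply]

/-- The operator-valued Fourier transform of an integrable function on `ℍ^d`,
`𝓕φ(l) f = ∫ φ(x) Π_l(x) f dx`, for `f ∈ L²(ℝ^d)`. -/
def fourierL1 {φ : Heis d → ℂ} (hφ : Integrable φ) (l : ℝ) : L2Euc d →L[ℂ] L2Euc d :=
  LinearMap.mkContinuous
    { toFun := fun f => ∫ x, φ x • schroedinger l x f
      map_add' := fun f g => by
        simp_rw [map_add, smul_add]
        exact integral_add (integrable_smul_schroedinger hφ l f)
          (integrable_smul_schroedinger hφ l g)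
      map_smul' := fun c f => by
        simp_rw [map_smul, RingHom.id_apply, smul_comm _ c]
        exact integral_smul c _ }
    (∫ x, ‖φ x‖)
    (fun f => by
      change ‖∫ x, φ x • schroedinger l x f‖ ≤ _
      refine (norm_integral_le_integral_norm _).trans (le_of_eq ?_)
      simp_rw [norm_smul, norm_schroedinger_apply]
      exact integral_mul_const _ _)

end Schroedinger

section HilbertSchmidt

/-- The index set of a fixed Hilbert basis of `L²(ℝ^d)`. -/
def l2BasisIndex (d : ℕ) : Set (L2Euc d) :=
  (exists_hilbertBasis ℂ (L2Euc d)).choose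

/-- A fixed Hilbert basis of `L²(ℝ^d)`. The Hilbert-Schmidt norm and inner product do not depend
on it. -/
def l2Basis (d : ℕ) : HilbertBasis (l2BasisIndex d) ℂ (L2Euc d) :=
  (exists_hilbertBasis ℂ (L2Euc d)).choose_spec.choose

/-- The square of the Hilbert-Schmidt norm, `∑ i, ‖T e_i‖²`, with value `∞` when `T` is not a
Hilbert-Schmidt operator. -/
def hsNormSq {d : ℕ} (T : L2Euc d →L[ℂ] L2Euc d) : ℝ≥0∞ :=
  ∑' i, ‖T (l2Basis d i)‖ₑ ^ 2

/-- The Hilbert-Schmidt inner product `⟨S, T⟩ = trace (S T†) = ∑ i, ⟨S e_i, T e_i⟩`, linear in `S`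
and conjugate-linear in `T` (Mathlib's `inner` is conjugate-linear in its first argument). -/
def hsInner {d : ℕ} (S T : L2Euc d →L[ℂ] L2Euc d) : ℂ :=
  ∑' i, inner ℂ (T (l2Basis d i)) (S (l2Basis d i))

end HilbertSchmidt

/-- `F` is a representative of the Fourier transform of `φ ∈ L²(ℍ^d)`: it is a (weakly) measurable
field of operators, and it is the limit, in the `L²` space of Hilbert-Schmidt fields with respect
to the Plancherel measure `|l|^d dl`, of the Fourier transforms of functions
`φ_n ∈ L¹ ∩ L²` that converge to `φ` in `L²`. -/
def IsFourierTransform {d : ℕ} (φ : L2Heis d) (F : ℝ → L2Euc d →L[ℂ] L2Euc d) : Prop :=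
  (∀ f g : L2Euc d, AEMeasurable (fun l => inner ℂ g (F l f)) volume) ∧
  ∃ (φn : ℕ → L2Heis d) (hn : ∀ n, Integrable (φn n)),
    Tendsto φn atTop (𝓝 φ) ∧
    Tendsto (fun n => ∫⁻ l : ℝ, hsNormSq (fourierL1 (hn n) l - F l) * ENNReal.ofReal (|l| ^ d))
      atTop (𝓝 0)

open Classical in
/-- The Fourier transform on `L²(ℍ^d)` (a representative of it, which is unique almost
everywhere): the Plancherel extension of `fourierL1` from `L¹ ∩ L²` to `L²`. -/
def heisFourier {d : ℕ} (φ : L2Heis d) : ℝ → L2Euc d →L[ℂ] L2Euc d :=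
  if h : ∃ F, IsFourierTransform φ F then h.choose else 0

/-- The bracket `[φ, ψ](α) = ∑_{j ∈ ℤ} ⟨𝓕φ(α + j), 𝓕ψ(α + j)⟩_HS |α + j|^d`. -/
def bracket {d : ℕ} (φ ψ : L2Heis d) (α : ℝ) : ℂ :=
  ∑' j : ℤ, hsInner (heisFourier φ (α + j)) (heisFourier ψ (α + j)) * ((|α + j| ^ d : ℝ) : ℂ)

/-- `E_ψ = {α ∈ (0, 1] : [ψ, ψ](α) > 0}` (the number `[ψ, ψ](α)` is real). -/
def bracketSupport {d : ℕ} (ψ : L2Heis d) : Set ℝ :=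
  {α | α ∈ Set.Ioc (0 : ℝ) 1 ∧ 0 < (bracket ψ ψ α).re}

section Lattice

variable {d : ℕ}

/-- The vector `M m ∈ ℝ^d`, for a real matrix `M` and an integer vector `m ∈ ℤ^d`. -/
def latticeVec (M : Matrix (Fin d) (Fin d) ℝ) (m : Fin d → ℤ) : EuclideanSpace ℝ (Fin d) :=
  WithLp.toLp 2 (M *ᵥ fun i => (m i : ℝ))

theorem latticeVec_add (M : Matrix (Fin d) (Fin d) ℝ) (m n : Fin d → ℤ) :
    latticeVec M (m + n) = latticeVec M m + latticeVec M n := by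
  have : (fun i => (((m + n) i : ℤ) : ℝ)) = (fun i => (m i : ℝ)) + fun i => (n i : ℝ) := by
    funext i; simp
  rw [latticeVec, this, Matrix.mulVec_add]; rfl

theorem latticeVec_neg (M : Matrix (Fin d) (Fin d) ℝ) (m : Fin d → ℤ) :
    latticeVec M (-m) = -latticeVec M m := by
  have : (fun i => (((-m) i : ℤ) : ℝ)) = -(fun i => (m i : ℝ)) := by
    funext i; simp
  rw [latticeVec, this, Matrix.mulVec_neg]; rfl

theorem latticeVec_zero (M : Matrix (Fin d) (Fin d) ℝ) : latticeVec M 0 = 0 := by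
  have : (fun i : Fin d => (((0 : Fin d → ℤ) i : ℤ) : ℝ)) = 0 := by funext i; simp
  rw [latticeVec, this, Matrix.mulVec_zero]; rfl

/-- A real matrix with integer entries. -/
def IsIntegerMatrix (M : Matrix (Fin d) (Fin d) ℝ) : Prop :=
  ∃ K : Matrix (Fin d) (Fin d) ℤ, M = K.map (fun k : ℤ => (k : ℝ))

theorem exists_int_inner {M N : Matrix (Fin d) (Fin d) ℝ} (h : IsIntegerMatrix (Mᵀ * N))
    (m n : Fin d → ℤ) : ∃ k : ℤ, inner ℝ (latticeVec M m) (latticeVec N n) = (k : ℝ) := by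
  obtain ⟨K, hK⟩ := h
  refine ⟨m ⬝ᵥ (K *ᵥ n), ?_⟩
  have h1 : inner ℝ (latticeVec M m) (latticeVec N n)
      = (M *ᵥ fun i => (m i : ℝ)) ⬝ᵥ (N *ᵥ fun i => (n i : ℝ)) := by
    simp only [latticeVec, EuclideanSpace.inner_toLp_toLp, star_trivial]
    exact dotProduct_comm _ _
  have h2 : (M *ᵥ fun i => (m i : ℝ)) ⬝ᵥ (N *ᵥ fun i => (n i : ℝ))
      = (fun i => (m i : ℝ)) ⬝ᵥ ((Mᵀ * N) *ᵥ fun i => (n i : ℝ)) := by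
    rw [← Matrix.mulVec_mulVec, Matrix.dotProduct_mulVec, Matrix.dotProduct_mulVec,
      Matrix.vecMul_transpose, ← Matrix.dotProduct_mulVec]
  rw [h1, h2, hK]
  simp [dotProduct, Matrix.mulVec]

/-- The set `Γ₁ = M ℤ^d × N ℤ^d`, viewed in `ℍ^d` as the set of elements `(M m, N n, 0)`. -/
def gammaOne (M N : Matrix (Fin d) (Fin d) ℝ) : Set (Heis d) :=
  {x | ∃ m n : Fin d → ℤ, x = Heis.mk (latticeVec M m) (latticeVec N n) 0}

/-- The subgroup `Γ = M ℤ^d × N ℤ^d × ℤ` of `ℍ^d`. -/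
def gammaLattice (M N : Matrix (Fin d) (Fin d) ℝ) (h : IsIntegerMatrix (Mᵀ * N)) :
    Subgroup (Heis d) where
  carrier := {x | ∃ (m n : Fin d → ℤ) (k : ℤ),
    x = Heis.mk (latticeVec M m) (latticeVec N n) (k : ℝ)}
  one_mem' := ⟨0, 0, 0, by rw [latticeVec_zero, latticeVec_zero, Int.cast_zero]; rfl⟩
  mul_mem' := by
    rintro _ _ ⟨m, n, k, rfl⟩ ⟨m', n', k', rfl⟩
    obtain ⟨c, hc⟩ := exists_int_inner h m n'
    exact ⟨m + m', n + n', k + k' + c, by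
      simp [Heis.mul_def, latticeVec_add, hc]⟩
  inv_mem' := by
    rintro _ ⟨m, n, k, rfl⟩
    obtain ⟨c, hc⟩ := exists_int_inner h m n
    exact ⟨-m, -n, -k + c, by simp [Heis.inv_def, latticeVec_neg, hc]⟩

end Lattice

/-- The closure of the linear span of a family of vectors. -/
def closedSpan {ι H : Type*} [NormedAddCommGroup H] [InnerProductSpace ℂ H] (v : ι → H) :
    Submodule ℂ H :=
  (Submodule.span ℂ (Set.range v)).topologicalClosure

/-- The family `v` is a frame with bounds `A`, `B` for the closure of its linear span:
`A ‖φ‖² ≤ ∑ i, |⟨φ, v i⟩|² ≤ B ‖φ‖²` for all `φ` in that space, the sum being convergent. -/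
def IsFrameForClosedSpan {ι H : Type*} [NormedAddCommGroup H] [InnerProductSpace ℂ H]
    (v : ι → H) (A B : ℝ) : Prop :=
  ∀ φ ∈ closedSpan v,
    Summable (fun i => ‖inner ℂ (v i) φ‖ ^ 2) ∧
    A * ‖φ‖ ^ 2 ≤ ∑' i, ‖inner ℂ (v i) φ‖ ^ 2 ∧
    ∑' i, ‖inner ℂ (v i) φ‖ ^ 2 ≤ B * ‖φ‖ ^ 2

end

/-! The centre of `Γ` carries the analysis. Translation by `(0, 0, s)` multiplies `𝓕ψ(l)` by the
scalar `e^{2πils}`. For an integer `s = k` this scalar depends only on `l` modulo 1, so Plancherel's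
theorem, folded over `ℤ`, shows that `⟨φ, L_{(0,0,k)} ψ⟩` is the `k`-th Fourier coefficient of `[φ,
ψ]` on `ℝ/ℤ` (`fourierCoeff_circleBracket`).

Two consequences follow. Off `E_ψ` the transform of `ψ` vanishes on the whole fibre `α + ℤ`, so the
hypothesis gives `[ψ, L_γ ψ] = 0` a.e. for `γ ∈ Γ₁` nontrivial. As `Γ` is a group, the subfamilies
`{L_g L_{(0,0,k)} ψ}_k`, `g ∈ Γ₁`, are then mutually orthogonal, and the frame inequalities can be
tested on each of them (`frameBoundsAt_orthogonal_iff`). Each subfamily is an isometric image of the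
one with `g = 1`, a stationary sequence with spectral density `w = [ψ, ψ]`. A finite combination
corresponds to a trigonometric polynomial `p`, its squared norm is `∫ |p|² w` and its frame sum is
`∫ |p|² w²`. The inequalities for all `p` say that `w (w - A)` and `w (B - w)` are nonnegative a.e.
(`stationary_frame_iff`).

The remaining work is Plancherel's theorem on `ℍ^d`. The operator `𝓕φ(l)` has as kernel a partial
Fourier transform of `φ`, whence the isometry on `L¹ ∩ L²` (`lintegral_hsNormSq_fourierL1`).
Operator fields are encoded by weighted matrix coefficients in a scalar `L²` space; there the
isometry extends to `fourierCoef`, and `hsCoef_heisFourier` identifies its values with the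
coefficients of the chosen representative. -/

noncomputable section

/-! ### Euclidean Plancherel theorem on `L¹ ∩ L²`. -/

section Plancherel

open FourierTransform
open scoped ContDiff

variable {V : Type*} [NormedAddCommGroup V] [InnerProductSpace ℝ V] [FiniteDimensional ℝ V]
  [MeasurableSpace V] [BorelSpace V]

theorem continuous_fourier_of_integrable {f : V → ℂ} (h1 : Integrable f) : Continuous (𝓕 f) :=
  VectorFourier.fourierIntegral_continuous Real.continuous_fourierChar
    continuous_inner h1

/-- On `L¹ ∩ L²` the `L²` Fourier transform is given by the Fourier integral. -/
theorem coeFn_fourier_toLp {f : V → ℂ} (h1 : Integrable f) (h2 : MemLp f 2 volume) :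
    (𝓕 (h2.toLp f) : Lp ℂ 2 (volume : Measure V)) =ᵐ[volume] 𝓕 f := by
  refine ae_eq_of_integral_contDiff_smul_eq
    ((Lp.memLp _).locallyIntegrable (by norm_num))
    (continuous_fourier_of_integrable h1).locallyIntegrable fun g hg hgc => ?_
  have hg₁ : HasCompactSupport (Complex.ofRealCLM ∘ g) := hgc.comp_left rfl
  have hg₂ : ContDiff ℝ ∞ (Complex.ofRealCLM ∘ g) := by fun_prop
  set G : SchwartzMap V ℂ := hg₁.toSchwartzMap hg₂ with hG
  have hGa : ∀ x, G x = (g x : ℂ) := fun x => rfl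
  -- Both transforms obey the multiplication formula `∫ 𝓕f · G = ∫ f · 𝓕G`, one as tempered
  -- distributions and the other by Fubini; testing against all smooth compactly supported `g` then
  -- identifies them.
  have key := congrArg (fun T => T G) (Lp.fourier_toTemperedDistribution_eq (h2.toLp f))
  simp only [TemperedDistribution.fourier_apply, Lp.toTemperedDistribution_apply] at key
  have e1 : ∫ x, g x • ((𝓕 (h2.toLp f) : Lp ℂ 2 (volume : Measure V)) x)
      = ∫ x, G x • ((𝓕 (h2.toLp f) : Lp ℂ 2 (volume : Measure V)) x) := by
    refine integral_congr_ae (Eventually.of_forall fun x => ?_)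
    simp [hGa]
  have e2 : ∫ x, g x • 𝓕 f x = ∫ x, G x • 𝓕 f x := by
    refine integral_congr_ae (Eventually.of_forall fun x => ?_)
    simp [hGa]
  rw [e1, e2, ← key]
  have e3 : ∫ x, (𝓕 G) x • (h2.toLp f) x = ∫ x, (𝓕 (G : V → ℂ)) x • f x := by
    refine integral_congr_ae ?_
    filter_upwards [h2.coeFn_toLp] with x hx
    rw [hx, SchwartzMap.fourier_coe]
  rw [e3]
  have := VectorFourier.integral_fourierIntegral_smul_eq_flip (L := innerₗ V)
    (μ := volume) (ν := volume)
    Real.continuous_fourierChar continuous_inner G.integrable h1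
  rw [flip_innerₗ] at this
  exact this

theorem lintegral_enorm_sq_fourier {f : V → ℂ} (h1 : Integrable f) (h2 : MemLp f 2 volume) :
    ∫⁻ w, ‖𝓕 f w‖ₑ ^ 2 = ∫⁻ v, ‖f v‖ₑ ^ 2 := by
  have h := Lp.norm_fourier_eq (h2.toLp f)
  rw [Lp.norm_def, Lp.norm_def, ENNReal.toReal_eq_toReal_iff' (Lp.eLpNorm_ne_top _)
    (Lp.eLpNorm_ne_top _), eLpNorm_congr_ae (coeFn_fourier_toLp h1 h2),
    eLpNorm_congr_ae h2.coeFn_toLp] at h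
  have hh : ∀ g : V → ℂ, eLpNorm g 2 volume ^ 2 = ∫⁻ v, ‖g v‖ₑ ^ 2 := fun g => by
    have := eLpNorm_nnreal_pow_eq_lintegral (f := g) (μ := volume) (p := 2) (by norm_num)
    simpa using this
  rw [← hh, ← hh, h]

end Plancherel

section PlancherelProd

variable {W : Type*} [NormedAddCommGroup W] [InnerProductSpace ℝ W] [FiniteDimensional ℝ W]
  [MeasurableSpace W] [BorelSpace W]

open FourierTransform

/-- Plancherel's theorem for functions on `W × ℝ` with the pairing `⟪η, q⟫ + s t`. -/
theorem lintegral_enorm_sq_fourier_prod {f : W × ℝ → ℂ} (h1 : Integrable f)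
    (h2 : MemLp f 2 volume) :
    ∫⁻ w : W × ℝ, ‖∫ v : W × ℝ, f v *
      Complex.exp (((-2 * Real.pi * (inner ℝ v.1 w.1 + v.2 * w.2) : ℝ) : ℂ) * Complex.I)‖ₑ ^ 2
      = ∫⁻ v, ‖f v‖ₑ ^ 2 := by
  -- `W × ℝ` carries the sup norm, so the Euclidean theorem is applied on `WithLp 2 (W × ℝ)` and
  -- transported by a measure-preserving map.
  have mp := WithLp.volume_preserving_ofLp W ℝ
  have me : MeasurableEmbedding (WithLp.ofLp : WithLp 2 (W × ℝ) → W × ℝ) :=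
    (MeasurableEquiv.toLp 2 (W × ℝ)).symm.measurableEmbedding
  have k1 : Integrable (fun v : WithLp 2 (W × ℝ) => f v.ofLp) := mp.integrable_comp_of_integrable h1
  have k2 : MemLp (fun v : WithLp 2 (W × ℝ) => f v.ofLp) 2 volume := h2.comp_measurePreserving mp
  have key := lintegral_enorm_sq_fourier k1 k2
  rw [mp.lintegral_comp_emb me (fun v => ‖f v‖ₑ ^ 2)] at key
  rw [← key, ← mp.lintegral_comp_emb me]
  refine lintegral_congr fun w => ?_
  congr 2
  rw [← mp.integral_comp me, Real.fourier_eq]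
  refine integral_congr_ae (Eventually.of_forall fun v => ?_)
  simp only [Circle.smul_def, Real.fourierChar_apply, smul_eq_mul, WithLp.prod_inner_apply]
  rw [mul_comm]
  congr 3
  push_cast
  simp
  ring

end PlancherelProd

/-! ### Parseval's identity, square integrability and scaling in `ℝ≥0∞`. -/

section General

theorem HilbertBasis.tsum_enorm_inner_sq {ι H : Type*} [NormedAddCommGroup H]
    [InnerProductSpace ℂ H] (b : HilbertBasis ι ℂ H) (x : H) :
    ∑' i, ‖inner ℂ (b i) x‖ₑ ^ 2 = ‖x‖ₑ ^ 2 := by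
  have h := b.hasSum_inner_mul_inner x x
  have h2 : HasSum (fun i => ‖inner ℂ (b i) x‖ ^ 2) (‖x‖ ^ 2) := by
    have h3 := h.mapL Complex.reCLM
    simp only [Complex.reCLM_apply] at h3
    convert! h3 using 1
    · funext i
      rw [← inner_conj_symm x (b i), Complex.conj_mul']
      norm_cast
    · rw [inner_self_eq_norm_sq_to_K]; norm_cast
  have h4 := h2.tsum_eq
  have h5 := ENNReal.ofReal_tsum_of_nonneg (fun i => by positivity) h2.summable
  rw [h4] at h5
  simp only [← ofReal_norm, ← ENNReal.ofReal_pow (norm_nonneg _)]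
  exact h5.symm

theorem lintegral_enorm_sq_eq_eLpNorm_sq {α : Type*} {m : MeasurableSpace α} {μ : Measure α}
    {F : Type*} [NormedAddCommGroup F] (f : α → F) :
    ∫⁻ x, ‖f x‖ₑ ^ 2 ∂μ = eLpNorm f 2 μ ^ 2 := by
  have := eLpNorm_nnreal_pow_eq_lintegral (f := f) (μ := μ) (p := 2) (by norm_num)
  simpa using this.symm

theorem Lp.lintegral_enorm_sq {α : Type*} {m : MeasurableSpace α} {μ : Measure α}
    {F : Type*} [NormedAddCommGroup F] (f : Lp F 2 μ) :
    ∫⁻ x, ‖f x‖ₑ ^ 2 ∂μ = ‖f‖ₑ ^ 2 := by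
  rw [lintegral_enorm_sq_eq_eLpNorm_sq, Lp.enorm_def]

theorem memLp_two_iff_lintegral {α : Type*} {m : MeasurableSpace α} {μ : Measure α}
    {F : Type*} [NormedAddCommGroup F] {f : α → F} (hf : AEStronglyMeasurable f μ) :
    MemLp f 2 μ ↔ ∫⁻ x, ‖f x‖ₑ ^ 2 ∂μ < ∞ := by
  rw [lintegral_enorm_sq_eq_eLpNorm_sq, MemLp]
  constructor
  · rintro ⟨-, h⟩; exact ENNReal.pow_lt_top h
  · intro h
    refine ⟨hf, ?_⟩
    by_contra hc
    rw [not_lt, top_le_iff] at hc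
    simp [hc] at h

/-- This Jacobian is where the Plancherel density `|l|^d` comes from. -/
theorem lintegral_comp_smul {W : Type*} [NormedAddCommGroup W] [InnerProductSpace ℝ W]
    [FiniteDimensional ℝ W] [MeasurableSpace W] [BorelSpace W] {g : W → ℝ≥0∞} (hg : Measurable g)
    {r : ℝ} (hr : r ≠ 0) :
    ENNReal.ofReal (|r| ^ Module.finrank ℝ W) * ∫⁻ y, g (r • y) = ∫⁻ y, g y := by
  rw [← lintegral_map hg (measurable_const_smul r), Measure.map_addHaar_smul _ hr,
    lintegral_smul_measure, smul_eq_mul, ← mul_assoc, ← ENNReal.ofReal_mul (by positivity),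
    abs_inv, abs_pow, mul_inv_cancel₀ (by positivity), ENNReal.ofReal_one, one_mul]

/-- Distinct members lie at distance `√2`, so balls of radius `1/2` around them are disjoint.
Countability lets sums over the basis commute with integrals and a.e. statements. -/
theorem Orthonormal.countable {ι H : Type*} [NormedAddCommGroup H] [InnerProductSpace ℂ H]
    [TopologicalSpace.SeparableSpace H] {v : ι → H} (hv : Orthonormal ℂ v) : Countable ι := by
  refine Pairwise.countable_of_isOpen_disjoint (s := fun i => Metric.ball (v i) (1 / 2)) ?_
    (fun i => Metric.isOpen_ball) (fun i => ⟨v i, Metric.mem_ball_self (by norm_num)⟩)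
  intro i j hij
  refine Metric.ball_disjoint_ball ?_
  have h : ‖v i - v j‖ ^ 2 = 2 := by
    rw [@norm_sub_sq ℂ, hv.1 i, hv.1 j, hv.2 hij]
    norm_num
  rw [dist_eq_norm]
  nlinarith [norm_nonneg (v i - v j)]

end General

instance {d : ℕ} : SecondCountableTopology (L2Euc d) :=
  have : Fact ((2 : ℝ≥0∞) ≠ ∞) := ⟨by norm_num⟩
  Lp.SecondCountableTopology

instance {d : ℕ} : Countable (l2BasisIndex d) := (l2Basis d).orthonormal.countable

namespace Heis

variable {d : ℕ}

@[fun_prop] theorem continuous_p : Continuous (Heis.p : Heis d → _) := continuous_fst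
@[fun_prop] theorem continuous_q : Continuous (Heis.q : Heis d → _) :=
  continuous_fst.comp continuous_snd
@[fun_prop] theorem continuous_t : Continuous (Heis.t : Heis d → _) :=
  continuous_snd.comp continuous_snd

end Heis

/-! ### The group Fourier transform as an integral operator; Plancherel on `L¹ ∩ L²`. -/

section Kernel

variable {d : ℕ}

/-- The scalar factor of the Schrödinger representation. -/
def schroedingerPhase (l : ℝ) (x : Heis d) (y : EuclideanSpace ℝ (Fin d)) : ℂ :=
  Complex.exp (((2 * Real.pi * l * x.t : ℝ) : ℂ) * Complex.I) * charE (l • x.q) y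

theorem norm_schroedingerPhase (l : ℝ) (x : Heis d) (y : EuclideanSpace ℝ (Fin d)) :
    ‖schroedingerPhase l x y‖ = 1 := by
  rw [schroedingerPhase, norm_mul, norm_charE, Complex.norm_exp_ofReal_mul_I, one_mul]

theorem continuous_schroedingerPhase (l : ℝ) :
    Continuous fun z : Heis d × EuclideanSpace ℝ (Fin d) => schroedingerPhase l z.1 z.2 := by
  unfold schroedingerPhase charE
  fun_prop

theorem coeFn_translation (a : EuclideanSpace ℝ (Fin d)) (f : L2Euc d) :
    translation a f =ᵐ[volume] fun y => f (y - a) :=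
  Lp.coeFn_compMeasurePreserving f (measurePreserving_sub_right volume a)

theorem coeFn_schroedinger (l : ℝ) (x : Heis d) (f : L2Euc d) :
    schroedinger l x f =ᵐ[volume] fun y => schroedingerPhase l x y * f (y - x.p) := by
  rw [schroedinger_apply]
  filter_upwards [Lp.coeFn_smul
    (Complex.exp (((2 * Real.pi * l * x.t : ℝ) : ℂ) * Complex.I))
    (modulation (l • x.q) (translation x.p f)), coeFn_modulation (l • x.q) (translation x.p f),
    coeFn_translation x.p f] with y h1 h2 h3
  rw [h1, Pi.smul_apply, h2, h3, smul_eq_mul, schroedingerPhase, mul_assoc (Complex.exp _)]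

theorem stronglyMeasurable_schroedinger_integrand {φ : Heis d → ℂ} (hm : StronglyMeasurable φ)
    (l : ℝ) (f : L2Euc d) :
    StronglyMeasurable fun z : Heis d × EuclideanSpace ℝ (Fin d) =>
      φ z.1 * (schroedingerPhase l z.1 z.2 * f (z.2 - z.1.p)) := by
  refine (hm.comp_measurable measurable_fst).mul
    ((continuous_schroedingerPhase l).stronglyMeasurable.mul
      ((Lp.stronglyMeasurable f).comp_measurable (Continuous.measurable ?_)))
  fun_prop

/-- As `f` is only square integrable, `y` is confined to a set of finite measure, where `|f| ≤ 1 +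
|f|²` bounds each slice by `|φ(x)| (vol s + ‖f‖²)`. -/
theorem integrable_schroedinger_integrand {φ : Heis d → ℂ} (hφ : Integrable φ)
    (hm : StronglyMeasurable φ) (l : ℝ) (f : L2Euc d) {s : Set (EuclideanSpace ℝ (Fin d))}
    (hs : volume s < ∞) :
    Integrable (fun z : Heis d × EuclideanSpace ℝ (Fin d) =>
      φ z.1 * (schroedingerPhase l z.1 z.2 * f (z.2 - z.1.p)))
      (volume.prod (volume.restrict s)) := by
  have : IsFiniteMeasure (volume.restrict s) := ⟨by simpa using hs⟩
  refine ⟨(stronglyMeasurable_schroedinger_integrand hm l f).aestronglyMeasurable, ?_⟩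
  rw [hasFiniteIntegral_iff_enorm, lintegral_prod _
    (stronglyMeasurable_schroedinger_integrand hm l f).enorm.aemeasurable]
  have hb : ∀ x : Heis d, ∫⁻ y in s, ‖φ x * (schroedingerPhase l x y * f (y - x.p))‖ₑ
      ≤ ‖φ x‖ₑ * (volume s + ‖f‖ₑ ^ 2) := by
    intro x
    have h1 : ∀ y, ‖φ x * (schroedingerPhase l x y * f (y - x.p))‖ₑ
        ≤ ‖φ x‖ₑ * (1 + ‖f (y - x.p)‖ₑ ^ 2) := by
      intro y
      have : ‖schroedingerPhase l x y‖ₑ = 1 := by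
        rw [← ofReal_norm, norm_schroedingerPhase, ENNReal.ofReal_one]
      rw [enorm_mul, enorm_mul, this, one_mul]
      gcongr
      rcases le_total ‖f (y - x.p)‖ₑ 1 with h | h
      · exact h.trans le_self_add
      · exact (le_self_pow h two_ne_zero).trans le_add_self
    refine (lintegral_mono h1).trans ?_
    rw [lintegral_const_mul' _ _ enorm_ne_top]
    gcongr
    rw [lintegral_add_left measurable_const, setLIntegral_one]
    gcongr
    refine (setLIntegral_le_lintegral _ _).trans ?_
    rw [lintegral_sub_right_eq_self (fun y => ‖f y‖ₑ ^ 2), Lp.lintegral_enorm_sq]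
  refine (lintegral_mono hb).trans_lt ?_
  rw [lintegral_mul_const' _ _ (by finiteness)]
  exact ENNReal.mul_lt_top (hasFiniteIntegral_iff_enorm.1 hφ.2) (by finiteness)

theorem ae_integrable_schroedinger_integrand {φ : Heis d → ℂ} (hφ : Integrable φ)
    (hm : StronglyMeasurable φ) (l : ℝ) (f : L2Euc d) :
    ∀ᵐ y : EuclideanSpace ℝ (Fin d), Integrable fun x : Heis d =>
      φ x * (schroedingerPhase l x y * f (y - x.p)) := by
  refine ae_of_forall_measure_lt_top_ae_restrict _ fun s _ hs => ?_
  exact (integrable_schroedinger_integrand hφ hm l f hs).prod_left_ae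

/-- `𝓕φ(l) f` is computed pointwise by the integral defining it. -/
theorem coeFn_fourierL1 {φ : Heis d → ℂ} (hφ : Integrable φ)
    (hm : StronglyMeasurable φ) (l : ℝ) (f : L2Euc d) :
    fourierL1 hφ l f =ᵐ[volume] fun y =>
      ∫ x : Heis d, φ x * (schroedingerPhase l x y * f (y - x.p)) := by
  refine ae_eq_of_forall_setIntegral_eq_of_sigmaFinite ?_ ?_ ?_
  · intro s _ hs
    have : IsFiniteMeasure (volume.restrict s) := ⟨by simpa using hs⟩
    exact ((Lp.memLp _).restrict s).integrable (by norm_num)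
  · intro s _ hs
    exact (integrable_schroedinger_integrand hφ hm l f hs).integral_prod_right
  · intro s hs hsf
    rw [integral_integral_swap]
    swap
    · exact (integrable_schroedinger_integrand hφ hm l f hsf).swap
    -- Integration over `s` is pairing with an indicator, a continuous functional on `L²`, hence it
    -- passes inside the vector-valued integral.
    rw [← L2.inner_indicatorConstLp_one hs hsf.ne]
    change inner ℂ _ (∫ x, φ x • schroedinger l x f) = _
    rw [← integral_inner (integrable_smul_schroedinger hφ l f)]
    refine integral_congr_ae (Eventually.of_forall fun x => ?_)
    simp only [inner_smul_right]
    rw [L2.inner_indicatorConstLp_one hs hsf.ne, ← integral_const_mul]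
    refine setIntegral_congr_ae hs ?_
    filter_upwards [coeFn_schroedinger l x f] with y hy _
    rw [hy]

/-- The partial Fourier transform in the variables `(q, t)` of a function on `ℍ^d`. -/
def partialFourier (φ : Heis d → ℂ)
    (z : EuclideanSpace ℝ (Fin d) × (EuclideanSpace ℝ (Fin d) × ℝ)) : ℂ :=
  ∫ v : EuclideanSpace ℝ (Fin d) × ℝ, φ (z.1, v) *
    Complex.exp (((-2 * Real.pi * (inner ℝ v.1 z.2.1 + v.2 * z.2.2) : ℝ) : ℂ) * Complex.I)

theorem stronglyMeasurable_partialFourier {φ : Heis d → ℂ} (hm : StronglyMeasurable φ) :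
    StronglyMeasurable (partialFourier φ) := by
  unfold partialFourier
  refine StronglyMeasurable.integral_prod_right (f := fun
    (z : EuclideanSpace ℝ (Fin d) × (EuclideanSpace ℝ (Fin d) × ℝ))
    (v : EuclideanSpace ℝ (Fin d) × ℝ) => φ (z.1, v) *
    Complex.exp (((-2 * Real.pi * (inner ℝ v.1 z.2.1 + v.2 * z.2.2) : ℝ) : ℂ) * Complex.I)) ?_
  refine StronglyMeasurable.mul ?_ (Continuous.stronglyMeasurable ?_)
  · exact hm.comp_measurable (g := fun x : (EuclideanSpace ℝ (Fin d) ×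
      (EuclideanSpace ℝ (Fin d) × ℝ)) × EuclideanSpace ℝ (Fin d) × ℝ => (x.1.1, x.2))
      ((measurable_fst.comp measurable_fst).prodMk measurable_snd)
  · fun_prop

/-- The phase `e^{2πilt} e^{-2πilq·y}` is the Fourier character in `(q, t)` at frequency `(l y,
-l)`, so integrating out `(q, t)` leaves an integral operator in `p`. -/
theorem coeFn_fourierL1_kernel {φ : Heis d → ℂ} (hφ : Integrable φ)
    (hm : StronglyMeasurable φ) (l : ℝ) (f : L2Euc d) :
    fourierL1 hφ l f =ᵐ[volume] fun y =>
      ∫ p, partialFourier φ (p, (l • y, -l)) * f (y - p) := by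
  filter_upwards [coeFn_fourierL1 hφ hm l f, ae_integrable_schroedinger_integrand hφ hm l f]
    with y hy hi
  rw [hy]
  have h1 := integral_prod (μ := (volume : Measure (EuclideanSpace ℝ (Fin d))))
    (ν := (volume : Measure (EuclideanSpace ℝ (Fin d) × ℝ)))
    (fun x : EuclideanSpace ℝ (Fin d) × (EuclideanSpace ℝ (Fin d) × ℝ) =>
      φ x * (schroedingerPhase l x y * f (y - Heis.p x))) hi
  refine h1.trans (integral_congr_ae (Eventually.of_forall fun p => ?_))
  simp only [partialFourier]
  rw [← integral_mul_const]
  refine integral_congr_ae (Eventually.of_forall fun v => ?_)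
  simp only [schroedingerPhase, charE, ← Complex.exp_add, mul_assoc]
  congr 2
  · simp only [Heis.q, Heis.t, real_inner_smul_left, real_inner_smul_right]
    push_cast
    ring_nf

/-- Up to conjugation these integrals are the basis coefficients of `z ↦ conj (k (y - z))`, so this
is Parseval's identity. -/
theorem tsum_enorm_sq_convolution_basis {k : EuclideanSpace ℝ (Fin d) → ℂ} (hk : MemLp k 2 volume)
    (y : EuclideanSpace ℝ (Fin d)) :
    ∑' i, ‖∫ p, k p * l2Basis d i (y - p)‖ₑ ^ 2 = ∫⁻ p, ‖k p‖ₑ ^ 2 := by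
  have mp : MeasurePreserving (fun z : EuclideanSpace ℝ (Fin d) => y - z) volume volume :=
    Measure.measurePreserving_sub_left volume y
  have h1 : MemLp (fun z => star (k (y - z))) 2 volume := (hk.comp_measurePreserving mp).star
  have h2 : ∀ i, ‖∫ p, k p * l2Basis d i (y - p)‖ₑ = ‖inner ℂ (l2Basis d i) (h1.toLp _)‖ₑ := by
    intro i
    rw [← inner_conj_symm, RCLike.enorm_conj, L2.inner_def,
      ← integral_sub_left_eq_self (fun p => k p * l2Basis d i (y - p)) volume y]
    congr 1
    refine integral_congr_ae ?_
    filter_upwards [h1.coeFn_toLp] with z hz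
    rw [hz]
    simp [RCLike.inner_apply, mul_comm]
  simp_rw [h2]
  rw [HilbertBasis.tsum_enorm_inner_sq, ← Lp.lintegral_enorm_sq,
    ← lintegral_sub_left_eq_self (fun p => ‖k p‖ₑ ^ 2) y]
  refine lintegral_congr_ae ?_
  filter_upwards [h1.coeFn_toLp] with z hz
  rw [hz]
  simp [enorm_eq_nnnorm]

/-- The Hilbert–Schmidt norm is the `L²` norm of the kernel: sum over the basis under the integral
in `y`. The assumption `hfin` makes almost every slice square integrable, as Parseval requires. -/
theorem hsNormSq_fourierL1 {φ : Heis d → ℂ} (hφ : Integrable φ)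
    (hm : StronglyMeasurable φ) (l : ℝ)
    (hfin : ∫⁻ y, ∫⁻ p, ‖partialFourier φ (p, (l • y, -l))‖ₑ ^ 2 < ∞) :
    hsNormSq (fourierL1 hφ l) = ∫⁻ y, ∫⁻ p, ‖partialFourier φ (p, (l • y, -l))‖ₑ ^ 2 := by
  have hmeas := stronglyMeasurable_partialFourier hm
  have hmeas2 : Measurable fun z : EuclideanSpace ℝ (Fin d) × EuclideanSpace ℝ (Fin d) =>
      ‖partialFourier φ (z.2, (l • z.1, -l))‖ₑ ^ 2 := by
    refine ((hmeas.comp_measurable (Continuous.measurable ?_)).enorm).pow_const 2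
    fun_prop
  have hae := ae_lt_top hmeas2.lintegral_prod_right' hfin.ne
  unfold hsNormSq
  simp_rw [← Lp.lintegral_enorm_sq (F := ℂ)]
  rw [← lintegral_tsum (fun i => ((Lp.stronglyMeasurable _).enorm.pow_const 2).aemeasurable)]
  refine lintegral_congr_ae ?_
  filter_upwards [hae, ae_all_iff.2 fun i => coeFn_fourierL1_kernel hφ hm l (l2Basis d i)]
    with y hy hy2
  simp_rw [hy2]
  refine tsum_enorm_sq_convolution_basis (k := fun p => partialFourier φ (p, (l • y, -l))) ?_ y
  rw [memLp_two_iff_lintegral]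
  · exact hy
  · refine (hmeas.comp_measurable (Continuous.measurable ?_)).aestronglyMeasurable
    fun_prop

/-- Substituting `η = l y` absorbs `|l|^d`, the sign of `l` is irrelevant after integration, and
Plancherel in `(q, t)` applies to almost every slice in `p`. -/
theorem lintegral_partialFourier {φ : Heis d → ℂ} (hφ : Integrable φ)
    (hm : StronglyMeasurable φ) (h2 : MemLp φ 2 volume) :
    ∫⁻ l : ℝ, (∫⁻ y, ∫⁻ p, ‖partialFourier φ (p, (l • y, -l))‖ₑ ^ 2) * ENNReal.ofReal (|l| ^ d)
      = ∫⁻ x, ‖φ x‖ₑ ^ 2 := by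
  have hmeas := ((stronglyMeasurable_partialFourier hm).enorm).pow_const 2
  have hcont : ∀ {X : Type} [TopologicalSpace X] [MeasurableSpace X] [OpensMeasurableSpace X]
      {g : X → EuclideanSpace ℝ (Fin d) × (EuclideanSpace ℝ (Fin d) × ℝ)}, Continuous g →
      Measurable fun x => ‖partialFourier φ (g x)‖ₑ ^ 2 :=
    fun hg => hmeas.comp hg.measurable
  have s1 : ∀ l : ℝ, l ≠ 0 →
      (∫⁻ y, ∫⁻ p, ‖partialFourier φ (p, (l • y, -l))‖ₑ ^ 2) * ENNReal.ofReal (|l| ^ d)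
      = ∫⁻ p, ∫⁻ η, ‖partialFourier φ (p, (η, -l))‖ₑ ^ 2 := by
    intro l hl
    rw [lintegral_lintegral_swap, mul_comm, ← lintegral_const_mul' _ _ ENNReal.ofReal_ne_top]
    · refine lintegral_congr fun p => ?_
      have := lintegral_comp_smul (g := fun η : EuclideanSpace ℝ (Fin d) =>
        ‖partialFourier φ (p, (η, -l))‖ₑ ^ 2) (hcont (by fun_prop)) hl
      rwa [finrank_euclideanSpace_fin] at this
    · exact (hcont (by fun_prop : Continuous fun z : EuclideanSpace ℝ (Fin d) ×
        EuclideanSpace ℝ (Fin d) => (z.2, (l • z.1, -l)))).aemeasurable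
  have hne : ∀ᵐ l : ℝ, l ≠ 0 := Measure.ae_ne volume 0
  calc _ = ∫⁻ l : ℝ, ∫⁻ p, ∫⁻ η, ‖partialFourier φ (p, (η, -l))‖ₑ ^ 2 :=
        lintegral_congr_ae (hne.mono s1)
    _ = ∫⁻ l : ℝ, ∫⁻ p, ∫⁻ η, ‖partialFourier φ (p, (η, l))‖ₑ ^ 2 :=
        lintegral_neg_eq_self (fun l : ℝ => ∫⁻ p, ∫⁻ η, ‖partialFourier φ (p, (η, l))‖ₑ ^ 2)
    _ = ∫⁻ p, ∫⁻ l : ℝ, ∫⁻ η, ‖partialFourier φ (p, (η, l))‖ₑ ^ 2 := by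
        refine lintegral_lintegral_swap (Measurable.aemeasurable ?_)
        exact Measurable.lintegral_prod_right' (f := fun z : (ℝ × EuclideanSpace ℝ (Fin d)) ×
          EuclideanSpace ℝ (Fin d) => ‖partialFourier φ (z.1.2, (z.2, z.1.1))‖ₑ ^ 2)
          (hcont (by fun_prop))
    _ = ∫⁻ p, ∫⁻ w, ‖partialFourier φ (p, w)‖ₑ ^ 2 := by
        refine lintegral_congr fun p => ?_
        exact (lintegral_prod_symm (μ := (volume : Measure (EuclideanSpace ℝ (Fin d))))
          (ν := (volume : Measure ℝ)) _ (hcont (by fun_prop)).aemeasurable).symm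
    _ = ∫⁻ p, ∫⁻ v : EuclideanSpace ℝ (Fin d) × ℝ, ‖φ (p, v)‖ₑ ^ 2 := by
        have i1 : ∀ᵐ p : EuclideanSpace ℝ (Fin d),
            Integrable fun v : EuclideanSpace ℝ (Fin d) × ℝ => φ (p, v) :=
          Integrable.prod_right_ae (μ := (volume : Measure (EuclideanSpace ℝ (Fin d))))
            (ν := (volume : Measure (EuclideanSpace ℝ (Fin d) × ℝ))) hφ
        have i2 : ∀ᵐ p : EuclideanSpace ℝ (Fin d),
            ∫⁻ v : EuclideanSpace ℝ (Fin d) × ℝ, ‖φ (p, v)‖ₑ ^ 2 < ∞ := by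
          refine ae_lt_top (Measurable.lintegral_prod_right' (f := fun z : Heis d => ‖φ z‖ₑ ^ 2)
            (hm.enorm.pow_const 2)) ?_
          have h := (memLp_two_iff_lintegral h2.1).1 h2
          have e := lintegral_prod (μ := (volume : Measure (EuclideanSpace ℝ (Fin d))))
            (ν := (volume : Measure (EuclideanSpace ℝ (Fin d) × ℝ)))
            (fun z => ‖φ z‖ₑ ^ 2) (hm.enorm.pow_const 2).aemeasurable
          exact (e.symm.trans_lt h).ne
        refine lintegral_congr_ae ?_
        filter_upwards [i1, i2] with p h1 h2
        exact lintegral_enorm_sq_fourier_prod h1 ((memLp_two_iff_lintegral h1.1).2 h2)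
    _ = ∫⁻ x, ‖φ x‖ₑ ^ 2 :=
        (lintegral_prod (μ := (volume : Measure (EuclideanSpace ℝ (Fin d))))
          (ν := (volume : Measure (EuclideanSpace ℝ (Fin d) × ℝ)))
          (fun z => ‖φ z‖ₑ ^ 2) (hm.enorm.pow_const 2).aemeasurable).symm

/-- The Plancherel theorem for the Heisenberg group on `L¹ ∩ L²`. -/
theorem lintegral_hsNormSq_fourierL1 (φ : L2Heis d) (hφ : Integrable φ) :
    ∫⁻ l : ℝ, hsNormSq (fourierL1 hφ l) * ENNReal.ofReal (|l| ^ d) = ‖φ‖ₑ ^ 2 := by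
  have hm := Lp.stronglyMeasurable φ
  have key := lintegral_partialFourier hφ hm (Lp.memLp φ)
  rw [Lp.lintegral_enorm_sq] at key
  rw [← key]
  have hmeas := ((stronglyMeasurable_partialFourier hm).enorm).pow_const 2
  have m1 : Measurable fun l : ℝ =>
      (∫⁻ y, ∫⁻ p, ‖partialFourier φ (p, (l • y, -l))‖ₑ ^ 2) * ENNReal.ofReal (|l| ^ d) := by
    refine Measurable.mul ?_ (by fun_prop)
    refine Measurable.lintegral_prod_right' (f := fun z : ℝ × EuclideanSpace ℝ (Fin d) =>
      ∫⁻ p, ‖partialFourier φ (p, (z.1 • z.2, -z.1))‖ₑ ^ 2) ?_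
    refine Measurable.lintegral_prod_right' (f := fun z : (ℝ × EuclideanSpace ℝ (Fin d)) ×
      EuclideanSpace ℝ (Fin d) => ‖partialFourier φ (z.2, (z.1.1 • z.1.2, -z.1.1))‖ₑ ^ 2) ?_
    refine hmeas.comp (Continuous.measurable ?_)
    fun_prop
  have hfin := ae_lt_top m1 (by rw [key]; finiteness)
  refine lintegral_congr_ae ?_
  filter_upwards [hfin, Measure.ae_ne volume (0 : ℝ)] with l hl hl0
  rw [hsNormSq_fourierL1 hφ hm]
  -- Only the weighted integral is known to be finite; the weight is positive because `l ≠ 0`, so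
  -- the first factor is finite too.
  refine lt_of_le_of_ne le_top fun htop => ?_
  rw [htop, ENNReal.top_mul] at hl
  · exact hl.ne rfl
  · simp only [ne_eq, ENNReal.ofReal_eq_zero, not_le]
    positivity

end Kernel

/-! ### Countable sums as integrals against counting measure. -/

section ProdCount

variable {α ι : Type*} {mα : MeasurableSpace α} {μ : Measure α} [Countable ι]
  [MeasurableSpace ι]

theorem ae_prod_count_iff {P : α × ι → Prop} :
    (∀ᵐ z ∂μ.prod Measure.count, P z) ↔ ∀ᵐ x ∂μ, ∀ i, P (x, i) := by
  constructor
  · intro h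
    filter_upwards [Measure.ae_ae_of_ae_prod h] with x hx
    exact Measure.ae_count_iff.1 hx
  · intro h
    filter_upwards [Measure.quasiMeasurePreserving_fst.ae h] with z hz using hz z.2

variable [MeasurableSingletonClass ι]

theorem aestronglyMeasurable_prod_count {g : α × ι → ℂ}
    (h : ∀ i, AEMeasurable (fun x => g (x, i)) μ) :
    AEStronglyMeasurable g (μ.prod Measure.count) := by
  refine AEMeasurable.aestronglyMeasurable ⟨fun z => (h z.2).mk _ z.1, ?_, ?_⟩
  · exact measurable_from_prod_countable_left fun i => (h i).measurable_mk
  · rw [EventuallyEq, ae_prod_count_iff, ae_all_iff]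
    exact fun i => (h i).ae_eq_mk

variable [SFinite μ]

theorem ae_summable_of_integrable_prod_count {f : α × ι → ℂ}
    (hf : Integrable f (μ.prod Measure.count)) : ∀ᵐ x ∂μ, Summable fun i => f (x, i) := by
  filter_upwards [hf.prod_right_ae] with x hx
  exact (integrable_count_iff.1 hx).of_norm

theorem integral_count_eq_tsum {f : ι → ℂ} (hf : Summable f) :
    ∫ i, f i ∂Measure.count = ∑' i, f i := by
  rw [integral_countable (integrable_count_iff.2 hf.norm)]
  simp [Measure.real]

theorem integrable_tsum_of_integrable_prod_count {f : α × ι → ℂ}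
    (hf : Integrable f (μ.prod Measure.count)) : Integrable (fun x => ∑' i, f (x, i)) μ := by
  refine hf.integral_prod_left.congr ?_
  filter_upwards [ae_summable_of_integrable_prod_count hf] with x hx
  exact integral_count_eq_tsum hx

theorem integral_tsum_of_integrable_prod_count {f : α × ι → ℂ}
    (hf : Integrable f (μ.prod Measure.count)) :
    ∫ x, ∑' i, f (x, i) ∂μ = ∫ z, f z ∂μ.prod Measure.count := by
  rw [integral_prod _ hf]
  refine integral_congr_ae ?_
  filter_upwards [ae_summable_of_integrable_prod_count hf] with x hx
  exact (integral_count_eq_tsum hx).symm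

end ProdCount

/-! ### Plancherel extension to `L²(ℍ^d)` through matrix coefficients. -/

section Coefficients

variable {d : ℕ}

instance : MeasurableSpace (l2BasisIndex d) := ⊤

instance : DiscreteMeasurableSpace (l2BasisIndex d) := ⟨fun _ => trivial⟩

/-- Pairs of basis vectors, indexing the matrix coefficients of a Hilbert-Schmidt operator. -/
abbrev HSIndex (d : ℕ) : Type := l2BasisIndex d × l2BasisIndex d

/-- The measure on which the matrix coefficients of operator fields live. -/
abbrev hsMeasure (d : ℕ) : Measure (ℝ × HSIndex d) := (volume : Measure ℝ).prod Measure.count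

/-- The matrix coefficients of an operator field, weighted by the square root of the Plancherel
density. -/
def hsCoef (F : ℝ → L2Euc d →L[ℂ] L2Euc d) (z : ℝ × HSIndex d) : ℂ :=
  ((√(|z.1| ^ d) : ℝ) : ℂ) * inner ℂ (l2Basis d z.2.2) (F z.1 (l2Basis d z.2.1))

theorem continuous_sqrt_abs_pow (d : ℕ) : Continuous fun l : ℝ => ((√(|l| ^ d) : ℝ) : ℂ) := by
  fun_prop

theorem aemeasurable_hsCoef_slice {F : ℝ → L2Euc d →L[ℂ] L2Euc d} (k : HSIndex d)
    (h : ∀ f g : L2Euc d, AEMeasurable (fun l => inner ℂ g (F l f)) volume) :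
    AEMeasurable fun l => hsCoef F (l, k) :=
  (continuous_sqrt_abs_pow d).aemeasurable.mul (h (l2Basis d k.1) (l2Basis d k.2))

theorem aestronglyMeasurable_hsCoef {F : ℝ → L2Euc d →L[ℂ] L2Euc d}
    (h : ∀ f g : L2Euc d, AEMeasurable (fun l => inner ℂ g (F l f)) volume) :
    AEStronglyMeasurable (hsCoef F) (hsMeasure d) :=
  aestronglyMeasurable_prod_count fun k => aemeasurable_hsCoef_slice k h

theorem enorm_sqrt_abs_pow_sq (l : ℝ) (d : ℕ) :
    ‖((√(|l| ^ d) : ℝ) : ℂ)‖ₑ ^ 2 = ENNReal.ofReal (|l| ^ d) := by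
  rw [← ofReal_norm, ← ENNReal.ofReal_pow (norm_nonneg _), Complex.norm_real, Real.norm_eq_abs,
    sq_abs, Real.sq_sqrt (by positivity)]

/-- Parseval in the output index recovers each `‖T e_i‖²`; the squared weight supplies the
Plancherel density. -/
theorem tsum_enorm_hsCoef_sq (F : ℝ → L2Euc d →L[ℂ] L2Euc d) (l : ℝ) :
    ∑' k, ‖hsCoef F (l, k)‖ₑ ^ 2 = hsNormSq (F l) * ENNReal.ofReal (|l| ^ d) := by
  have h : ∀ k : HSIndex d, ‖hsCoef F (l, k)‖ₑ ^ 2 = ENNReal.ofReal (|l| ^ d) *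
      ‖inner ℂ (l2Basis d k.2) (F l (l2Basis d k.1))‖ₑ ^ 2 := by
    intro k
    rw [hsCoef, enorm_mul, mul_pow, enorm_sqrt_abs_pow_sq]
  simp_rw [h]
  rw [ENNReal.tsum_mul_left, mul_comm, hsNormSq]
  congr 1
  refine (ENNReal.tsum_prod (f := fun i j =>
    ‖inner ℂ (l2Basis d j) (F l (l2Basis d i))‖ₑ ^ 2)).trans ?_
  exact tsum_congr fun i => HilbertBasis.tsum_enorm_inner_sq _ _

theorem lintegral_hsMeasure {g : ℝ × HSIndex d → ℂ} (hg : AEStronglyMeasurable g (hsMeasure d)) :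
    ∫⁻ z, ‖g z‖ₑ ^ 2 ∂hsMeasure d = ∫⁻ l : ℝ, ∑' k, ‖g (l, k)‖ₑ ^ 2 := by
  rw [lintegral_prod _ (hg.enorm.pow_const 2)]
  exact lintegral_congr fun l => lintegral_count _

theorem eLpNorm_hsCoef_sq {F : ℝ → L2Euc d →L[ℂ] L2Euc d}
    (h : AEStronglyMeasurable (hsCoef F) (hsMeasure d)) :
    eLpNorm (hsCoef F) 2 (hsMeasure d) ^ 2
      = ∫⁻ l : ℝ, hsNormSq (F l) * ENNReal.ofReal (|l| ^ d) := by
  rw [← lintegral_enorm_sq_eq_eLpNorm_sq, lintegral_hsMeasure h]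
  exact lintegral_congr fun l => tsum_enorm_hsCoef_sq F l

theorem hsCoef_sub (F G : ℝ → L2Euc d →L[ℂ] L2Euc d) :
    hsCoef (fun l => F l - G l) = hsCoef F - hsCoef G := by
  funext z
  simp [hsCoef, inner_sub_right, mul_sub]

theorem continuous_schroedinger_parameter (x : Heis d) (f : L2Euc d) :
    Continuous fun l : ℝ => schroedinger l x f := by
  simp_rw [schroedinger_apply]
  have h1 : Continuous fun l : ℝ =>
      Complex.exp (((2 * Real.pi * l * x.t : ℝ) : ℂ) * Complex.I) := by fun_prop
  have h2 : Continuous fun l : ℝ => l • x.q := by fun_prop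
  exact h1.smul ((continuous_modulation (translation x.p f)).comp h2)

theorem continuous_fourierL1_apply {φ : Heis d → ℂ} (hφ : Integrable φ) (f : L2Euc d) :
    Continuous fun l => fourierL1 hφ l f := by
  change Continuous fun l => ∫ x, φ x • schroedinger l x f
  refine continuous_of_dominated (bound := fun x => ‖φ x‖ * ‖f‖)
    (fun l => (integrable_smul_schroedinger hφ l f).1) (fun l => Eventually.of_forall fun x => ?_)
    (hφ.norm.mul_const _) (Eventually.of_forall fun x => ?_)
  · rw [norm_smul, norm_schroedinger_apply]
  · exact (continuous_schroedinger_parameter x f).const_smul (φ x)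

theorem aemeasurable_inner_fourierL1 {φ : Heis d → ℂ} (hφ : Integrable φ) (f g : L2Euc d) :
    AEMeasurable (fun l => inner ℂ g (fourierL1 hφ l f)) volume :=
  (continuous_const.inner (continuous_fourierL1_apply hφ f)).aemeasurable

theorem aestronglyMeasurable_hsCoef_fourierL1 {φ : Heis d → ℂ} (hφ : Integrable φ) :
    AEStronglyMeasurable (hsCoef (fourierL1 hφ)) (hsMeasure d) :=
  aestronglyMeasurable_hsCoef (aemeasurable_inner_fourierL1 hφ)

theorem eLpNorm_hsCoef_fourierL1 (φ : L2Heis d) (hφ : Integrable φ) :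
    eLpNorm (hsCoef (fourierL1 hφ)) 2 (hsMeasure d) = ‖φ‖ₑ := by
  have h := eLpNorm_hsCoef_sq (aestronglyMeasurable_hsCoef_fourierL1 hφ)
  rw [lintegral_hsNormSq_fourierL1] at h
  exact (ENNReal.pow_right_strictMono two_ne_zero).injective h

theorem memLp_hsCoef_fourierL1 (φ : L2Heis d) (hφ : Integrable φ) :
    MemLp (hsCoef (fourierL1 hφ)) 2 (hsMeasure d) :=
  ⟨aestronglyMeasurable_hsCoef_fourierL1 hφ, by
    rw [eLpNorm_hsCoef_fourierL1 φ hφ]; exact enorm_lt_top⟩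

theorem fourierL1_apply {φ : Heis d → ℂ} (hφ : Integrable φ) (l : ℝ) (f : L2Euc d) :
    fourierL1 hφ l f = ∫ x, φ x • schroedinger l x f := rfl

theorem fourierL1_congr {φ χ : Heis d → ℂ} (hφ : Integrable φ) (hχ : Integrable χ)
    (h : φ =ᵐ[volume] χ) (l : ℝ) : fourierL1 hφ l = fourierL1 hχ l := by
  ext1 f
  rw [fourierL1_apply, fourierL1_apply]
  refine integral_congr_ae ?_
  filter_upwards [h] with x hx
  rw [hx]

/-- `L¹ ∩ L²(ℍ^d)` as a subspace of `L²(ℍ^d)`. -/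
def integrableSubmodule (d : ℕ) : Submodule ℂ (L2Heis d) where
  carrier := {φ | Integrable (φ : Heis d → ℂ) volume}
  zero_mem' := (integrable_congr (Lp.coeFn_zero ℂ 2 volume)).2 (integrable_zero _ _ _)
  add_mem' {f g} hf hg := (integrable_congr (Lp.coeFn_add f g)).2 (Integrable.add hf hg)
  smul_mem' c f hf := (integrable_congr (Lp.coeFn_smul c f)).2 (Integrable.smul c hf)

theorem integrable_of_mem_integrableSubmodule {φ : L2Heis d} (h : φ ∈ integrableSubmodule d) :
    Integrable φ := h

theorem dense_integrableSubmodule (d : ℕ) : Dense (integrableSubmodule d : Set (L2Heis d)) := by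
  refine (Lp.simpleFunc.dense (E := ℂ) (μ := (volume : Measure (Heis d))) (p := 2)
    (by norm_num)).mono fun f hf => ?_
  have h := Lp.simpleFunc.memLp ⟨f, hf⟩
  have h1 : Integrable (Lp.simpleFunc.toSimpleFunc ⟨f, hf⟩) :=
    (SimpleFunc.memLp_iff_integrable (by norm_num) (by norm_num)).1 h
  exact (integrable_congr (Lp.simpleFunc.toSimpleFunc_eq_toFun ⟨f, hf⟩)).1 h1

theorem fourierL1_add {f g : L2Heis d} (hf : Integrable f) (hg : Integrable g)
    (hfg : Integrable (f + g : L2Heis d)) (l : ℝ) :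
    fourierL1 hfg l = fourierL1 hf l + fourierL1 hg l := by
  rw [fourierL1_congr _ (Integrable.add hf hg) (Lp.coeFn_add f g)]
  ext1 h
  simp only [fourierL1_apply, _root_.add_apply, Pi.add_apply, add_smul]
  exact integral_add (integrable_smul_schroedinger hf _ h) (integrable_smul_schroedinger hg _ h)

theorem fourierL1_smul {f : L2Heis d} (c : ℂ) (hf : Integrable f)
    (hcf : Integrable (c • f : L2Heis d)) (l : ℝ) :
    fourierL1 hcf l = c • fourierL1 hf l := by
  rw [fourierL1_congr _ (Integrable.smul c hf) (Lp.coeFn_smul c f)]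
  ext1 h
  simp only [fourierL1_apply, _root_.smul_apply, Pi.smul_apply, smul_assoc]
  exact integral_smul c _

/-- The matrix coefficients of the Fourier transform on `L¹ ∩ L²`. -/
def fourierCoefL1 (d : ℕ) : integrableSubmodule d →ₗ[ℂ] Lp ℂ 2 (hsMeasure d) where
  toFun φ := (memLp_hsCoef_fourierL1 φ.1 (integrable_of_mem_integrableSubmodule φ.2)).toLp _
  map_add' f g := by
    rw [← MemLp.toLp_add]
    refine MemLp.toLp_congr _ _ (Eventually.of_forall fun z => ?_)
    have := fourierL1_add (integrable_of_mem_integrableSubmodule f.2)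
      (integrable_of_mem_integrableSubmodule g.2)
      (integrable_of_mem_integrableSubmodule (f + g).2) z.1
    simp only [hsCoef, Pi.add_apply, this, _root_.add_apply, inner_add_right, mul_add]
  map_smul' c f := by
    rw [RingHom.id_apply, ← MemLp.toLp_const_smul]
    refine MemLp.toLp_congr _ _ (Eventually.of_forall fun z => ?_)
    have := fourierL1_smul c (integrable_of_mem_integrableSubmodule f.2)
      (integrable_of_mem_integrableSubmodule (c • f).2) z.1
    simp only [hsCoef, Pi.smul_apply, this, _root_.smul_apply, inner_smul_right, smul_eq_mul]
    ring

theorem norm_fourierCoefL1 (φ : integrableSubmodule d) : ‖fourierCoefL1 d φ‖ = ‖φ.1‖ := by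
  change ‖(memLp_hsCoef_fourierL1 φ.1 (integrable_of_mem_integrableSubmodule φ.2)).toLp _‖ = _
  rw [Lp.norm_toLp, eLpNorm_hsCoef_fourierL1, toReal_enorm]

theorem denseRange_integrableSubmodule : DenseRange (integrableSubmodule d).subtype := by
  rw [DenseRange, Submodule.coe_subtype, Subtype.range_coe]
  exact dense_integrableSubmodule d

theorem fourierCoef_extend_apply (φ : integrableSubmodule d) :
    (fourierCoefL1 d).extendOfNorm (integrableSubmodule d).subtype φ.1 = fourierCoefL1 d φ :=
  LinearMap.extendOfNorm_eq denseRange_integrableSubmodule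
    ⟨1, fun x => by rw [one_mul, norm_fourierCoefL1]; rfl⟩ φ

/-- The matrix coefficients of the Fourier transform, as an isometry of `L²(ℍ^d)`. -/
def fourierCoef (d : ℕ) : L2Heis d →ₗᵢ[ℂ] Lp ℂ 2 (hsMeasure d) where
  toLinearMap := ((fourierCoefL1 d).extendOfNorm (integrableSubmodule d).subtype).toLinearMap
  norm_map' φ := by
    refine (dense_integrableSubmodule d).induction (P := fun φ =>
      ‖(fourierCoefL1 d).extendOfNorm (integrableSubmodule d).subtype φ‖ = ‖φ‖) ?_ ?_ φ
    · intro φ hφ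
      rw [fourierCoef_extend_apply ⟨φ, hφ⟩, norm_fourierCoefL1]
    · exact isClosed_eq (by fun_prop) (by fun_prop)

theorem coeFn_fourierCoef_of_integrable (φ : L2Heis d) (hφ : Integrable φ) :
    fourierCoef d φ =ᵐ[hsMeasure d] hsCoef (fourierL1 hφ) := by
  have h : fourierCoef d φ = fourierCoefL1 d ⟨φ, hφ⟩ := fourierCoef_extend_apply ⟨φ, hφ⟩
  rw [h]
  exact MemLp.coeFn_toLp (memLp_hsCoef_fourierL1 φ hφ)

theorem lintegral_hsNormSq_sub {F G : ℝ → L2Euc d →L[ℂ] L2Euc d}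
    (hF : AEStronglyMeasurable (hsCoef F) (hsMeasure d))
    (hG : AEStronglyMeasurable (hsCoef G) (hsMeasure d)) :
    ∫⁻ l : ℝ, hsNormSq (F l - G l) * ENNReal.ofReal (|l| ^ d)
      = eLpNorm (hsCoef F - hsCoef G) 2 (hsMeasure d) ^ 2 := by
  have h := hF.sub hG
  rw [← hsCoef_sub] at h ⊢
  exact (eLpNorm_hsCoef_sq h).symm

theorem ENNReal.tendsto_zero_of_sq {ι : Type*} {u : ι → ℝ≥0∞} {L : Filter ι}
    (h : Tendsto (fun n => u n ^ 2) L (𝓝 0)) : Tendsto u L (𝓝 0) := by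
  rw [ENNReal.tendsto_nhds_zero] at h ⊢
  intro ε hε
  filter_upwards [h (ε ^ 2) (by positivity)] with n hn
  exact (ENNReal.pow_le_pow_left_iff two_ne_zero).1 hn

theorem tendsto_eLpNorm_fourierCoef {φn : ℕ → L2Heis d} {φ : L2Heis d}
    (hφ : Tendsto φn atTop (𝓝 φ)) :
    Tendsto (fun n => eLpNorm (⇑(fourierCoef d (φn n)) - ⇑(fourierCoef d φ)) 2 (hsMeasure d))
      atTop (𝓝 0) :=
  (Lp.tendsto_Lp_iff_tendsto_eLpNorm' _ _).1 (((fourierCoef d).continuous.tendsto φ).comp hφ)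

/-- The coefficients of the approximants `φ_n` converge in `L²` to both sides. Hence the arbitrary
choice of representative in `heisFourier` is harmless. -/
theorem hsCoef_ae_eq_fourierCoef {φ : L2Heis d} {F : ℝ → L2Euc d →L[ℂ] L2Euc d}
    (h : IsFourierTransform φ F) : hsCoef F =ᵐ[hsMeasure d] fourierCoef d φ := by
  obtain ⟨hm, φn, hn, hφ, hF⟩ := h
  have hFm := aestronglyMeasurable_hsCoef hm
  have m : ∀ n, AEStronglyMeasurable (hsCoef (fourierL1 (hn n))) (hsMeasure d) :=
    fun n => aestronglyMeasurable_hsCoef_fourierL1 (hn n)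
  simp_rw [lintegral_hsNormSq_sub (m _) hFm] at hF
  have h2 := ENNReal.tendsto_zero_of_sq hF
  have h3 := tendsto_eLpNorm_fourierCoef hφ
  have h23 := h2.add h3
  rw [add_zero] at h23
  have h4 : eLpNorm (hsCoef F - ⇑(fourierCoef d φ)) 2 (hsMeasure d) = 0 := by
    refine le_antisymm (ge_of_tendsto' h23 fun n => ?_) bot_le
    have e : hsCoef F - ⇑(fourierCoef d φ)
        =ᵐ[hsMeasure d] (hsCoef F - hsCoef (fourierL1 (hn n)))
          + (⇑(fourierCoef d (φn n)) - ⇑(fourierCoef d φ)) := by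
      filter_upwards [coeFn_fourierCoef_of_integrable (φn n) (hn n)] with z hz
      simp only [Pi.sub_apply, Pi.add_apply, hz]
      ring
    rw [eLpNorm_congr_ae e]
    refine (eLpNorm_add_le (hFm.sub (m n))
      ((Lp.aestronglyMeasurable _).sub (Lp.aestronglyMeasurable _)) (by norm_num)).trans ?_
    rw [eLpNorm_sub_comm]
  rw [eLpNorm_eq_zero_iff (hFm.sub (Lp.aestronglyMeasurable _)) (by norm_num)] at h4
  filter_upwards [h4] with z hz using sub_eq_zero.1 hz

/-- A square summable matrix is the matrix of a Hilbert-Schmidt operator. -/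
theorem HilbertBasis.exists_clm_of_summable {ι H : Type*} [NormedAddCommGroup H]
    [InnerProductSpace ℂ H] [CompleteSpace H] (b : HilbertBasis ι ℂ H) (c : ι → ι → ℂ)
    (hc : Summable fun k : ι × ι => ‖c k.1 k.2‖ ^ 2) :
    ∃ T : H →L[ℂ] H, ∀ i j, inner ℂ (b j) (T (b i)) = c i j := by
  have hc' : Summable fun k : ι × ι => ‖c k.2 k.1‖ ^ 2 := hc.prod_symm
  have hcol : ∀ j, Memℓp (fun i => star (c i j)) 2 := by
    intro j
    rw [memℓp_gen_iff (by norm_num)]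
    simpa using hc'.prod_factor j
  -- The vector `w j` represents `f ↦ ⟨b j, T f⟩`: the `star` in its coordinates gives `⟨w j, b i⟩ =
  -- c i j`. The operator is `f ↦ ∑ j, ⟨w j, f⟩ b j`, bounded by `√(∑ ‖w j‖²)` through
  -- Cauchy–Schwarz.
  let w : ι → H := fun j => b.repr.symm ⟨_, hcol j⟩
  have hwn : ∀ j, ‖w j‖ ^ 2 = ∑' i, ‖c i j‖ ^ 2 := by
    intro j
    rw [LinearIsometryEquiv.norm_map]
    have := lp.norm_rpow_eq_tsum (p := 2) (by norm_num) (⟨_, hcol j⟩ : lp (fun _ : ι => ℂ) 2)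
    simpa using this
  have hws : Summable fun j => ‖w j‖ ^ 2 := by
    simp_rw [hwn]
    exact hc'.prod
  have hle : ∀ f j, ‖inner ℂ (w j) f‖ ^ 2 ≤ ‖w j‖ ^ 2 * ‖f‖ ^ 2 := by
    intro f j
    rw [← mul_pow]
    gcongr
    exact norm_inner_le_norm _ _
  have hsum : ∀ f, Summable fun j => ‖inner ℂ (w j) f‖ ^ 2 := fun f =>
    Summable.of_nonneg_of_le (fun j => by positivity) (hle f) (hws.mul_right _)
  have hmem : ∀ f, Memℓp (fun j => inner ℂ (w j) f) 2 := by
    intro f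
    rw [memℓp_gen_iff (by norm_num)]
    simpa using hsum f
  let T₀ : H →ₗ[ℂ] H :=
    { toFun := fun f => b.repr.symm ⟨_, hmem f⟩
      map_add' := fun f g => by
        rw [← map_add]
        congr 1
        ext j
        exact inner_add_right _ _ _
      map_smul' := fun a f => by
        rw [RingHom.id_apply, ← map_smul]
        congr 1
        ext j
        exact inner_smul_right _ _ _ }
  refine ⟨T₀.mkContinuous (√(∑' j, ‖w j‖ ^ 2)) fun f => ?_, fun i j => ?_⟩
  · have h1 : ‖T₀ f‖ ^ 2 = ∑' j, ‖inner ℂ (w j) f‖ ^ 2 := by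
      change ‖b.repr.symm _‖ ^ 2 = _
      rw [LinearIsometryEquiv.norm_map]
      have := lp.norm_rpow_eq_tsum (p := 2) (by norm_num) (⟨_, hmem f⟩ : lp (fun _ : ι => ℂ) 2)
      simpa using this
    refine le_of_sq_le_sq ?_ (by positivity)
    rw [h1, mul_pow, Real.sq_sqrt (tsum_nonneg fun j => by positivity), ← tsum_mul_right]
    exact (hsum f).tsum_le_tsum (hle f) (hws.mul_right _)
  · change inner ℂ (b j) (b.repr.symm _) = _
    rw [← b.repr_apply_apply, LinearIsometryEquiv.apply_symm_apply]
    change inner ℂ (b.repr.symm _) (b i) = _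
    rw [← inner_conj_symm, ← b.repr_apply_apply, LinearIsometryEquiv.apply_symm_apply]
    exact Complex.conj_conj _

/-- Expanding `f` and then `g` in the countable basis exhibits the pairing as an iterated sum of
measurable functions. -/
theorem HilbertBasis.aemeasurable_inner_apply {ι H α : Type*} [Countable ι]
    {m : MeasurableSpace α} {μ : Measure α} [NormedAddCommGroup H]
    [InnerProductSpace ℂ H] [CompleteSpace H] (b : HilbertBasis ι ℂ H) {F : α → H →L[ℂ] H}
    (hF : ∀ i j, AEMeasurable (fun x => inner ℂ (b j) (F x (b i))) μ) (f g : H) :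
    AEMeasurable (fun x => inner ℂ g (F x f)) μ := by
  have h1 : ∀ j, AEMeasurable (fun x => inner ℂ (b j) (F x f)) μ := by
    intro j
    have : ∀ x, inner ℂ (b j) (F x f) = ∑' i, inner ℂ (b j) (F x (b i)) * inner ℂ (b i) f := by
      intro x
      rw [← ContinuousLinearMap.adjoint_inner_left, ← b.tsum_inner_mul_inner]
      simp_rw [ContinuousLinearMap.adjoint_inner_left]
    simp_rw [this]
    exact AEMeasurable.tsum fun i => (hF i j).mul_const _
  have h2 : ∀ x, inner ℂ g (F x f) = ∑' j, inner ℂ g (b j) * inner ℂ (b j) (F x f) :=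
    fun x => (b.tsum_inner_mul_inner _ _).symm
  simp_rw [h2]
  exact AEMeasurable.tsum fun j => (h1 j).const_mul _

theorem ae_summable_norm_sq (h : Lp ℂ 2 (hsMeasure d)) :
    ∀ᵐ l : ℝ, Summable fun k => ‖h (l, k)‖ ^ 2 := by
  have h1 := Lp.lintegral_enorm_sq h
  rw [lintegral_hsMeasure (Lp.aestronglyMeasurable h)] at h1
  have hm : Measurable fun l : ℝ => ∑' k, ‖h (l, k)‖ₑ ^ 2 := by
    refine Measurable.tsum fun k => ?_
    exact ((Lp.stronglyMeasurable h).enorm.pow_const 2).comp measurable_prodMk_right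
  filter_upwards [ae_lt_top hm (by rw [h1]; finiteness)] with l hl
  have h2 : ∀ k, ‖h (l, k)‖ₑ ^ 2 = ENNReal.ofReal (‖h (l, k)‖ ^ 2) := fun k => by
    rw [ENNReal.ofReal_pow (norm_nonneg _), ofReal_norm]
  simp_rw [h2] at hl
  exact (ENNReal.summable_toReal hl.ne).congr fun k => ENNReal.toReal_ofReal (by positivity)

theorem exists_hsCoef_eq (h : Lp ℂ 2 (hsMeasure d)) :
    ∃ F : ℝ → L2Euc d →L[ℂ] L2Euc d,
      (∀ f g : L2Euc d, AEMeasurable (fun l => inner ℂ g (F l f)) volume) ∧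
      hsCoef F =ᵐ[hsMeasure d] h := by
  have key : ∀ l : ℝ, ∃ T : L2Euc d →L[ℂ] L2Euc d, Summable (fun k => ‖h (l, k)‖ ^ 2) →
      ∀ i j, inner ℂ (l2Basis d j) (T (l2Basis d i)) =
        ((√(|l| ^ d) : ℝ) : ℂ)⁻¹ * h (l, (i, j)) := by
    intro l
    by_cases hs : Summable fun k => ‖h (l, k)‖ ^ 2
    · obtain ⟨T, hT⟩ := (l2Basis d).exists_clm_of_summable
        (fun i j => ((√(|l| ^ d) : ℝ) : ℂ)⁻¹ * h (l, (i, j))) (by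
          simp_rw [norm_mul, mul_pow]
          exact hs.mul_left _)
      exact ⟨T, fun _ => hT⟩
    -- A dummy value: by `ae_summable_norm_sq` this happens only for a null set of `l`.
    · exact ⟨0, fun h => absurd h hs⟩
  choose F hF using key
  refine ⟨F, fun f g => ?_, ?_⟩
  · refine (l2Basis d).aemeasurable_inner_apply (fun i j => ?_) f g
    have hm : Measurable fun l : ℝ => ((√(|l| ^ d) : ℝ) : ℂ)⁻¹ * h (l, (i, j)) := by
      refine Measurable.mul ?_
        ((Lp.stronglyMeasurable h).measurable.comp measurable_prodMk_right)
      refine Measurable.inv (Continuous.measurable ?_)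
      fun_prop
    refine ⟨_, hm, ?_⟩
    filter_upwards [ae_summable_norm_sq h] with l hl using hF l hl i j
  · rw [EventuallyEq, ae_prod_count_iff]
    filter_upwards [ae_summable_norm_sq h, Measure.ae_ne volume (0 : ℝ)] with l hl hl0 k
    have : 0 < √(|l| ^ d) := by positivity
    rw [hsCoef, hF l hl k.1 k.2, mul_inv_cancel_left₀ (by exact_mod_cast this.ne')]

/-- Existence ensures that the conditional in `heisFourier` never falls back on its default value.
-/
theorem exists_isFourierTransform (φ : L2Heis d) : ∃ F, IsFourierTransform φ F := by
  obtain ⟨F, hF, hc⟩ := exists_hsCoef_eq (fourierCoef d φ)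
  obtain ⟨φn, hn', hlim⟩ := mem_closure_iff_seq_limit.1 (dense_integrableSubmodule d φ)
  have hn : ∀ n, Integrable (φn n) := fun n => integrable_of_mem_integrableSubmodule (hn' n)
  refine ⟨F, hF, φn, hn, hlim, ?_⟩
  have hFm := aestronglyMeasurable_hsCoef hF
  simp_rw [lintegral_hsNormSq_sub (aestronglyMeasurable_hsCoef_fourierL1 (hn _)) hFm]
  have h3 := ENNReal.Tendsto.pow (n := 2) (tendsto_eLpNorm_fourierCoef hlim)
  rw [zero_pow two_ne_zero] at h3
  refine h3.congr fun n => ?_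
  rw [eLpNorm_congr_ae ((coeFn_fourierCoef_of_integrable (φn n) (hn n)).sub hc.symm)]

theorem isFourierTransform_heisFourier (φ : L2Heis d) : IsFourierTransform φ (heisFourier φ) := by
  rw [heisFourier, dif_pos (exists_isFourierTransform φ)]
  exact (exists_isFourierTransform φ).choose_spec

theorem hsCoef_heisFourier (φ : L2Heis d) :
    hsCoef (heisFourier φ) =ᵐ[hsMeasure d] fourierCoef d φ :=
  hsCoef_ae_eq_fourierCoef (isFourierTransform_heisFourier φ)

end Coefficients

/-! ### Fourier series on the circle and stationary sequences. -/

section FourierUniqueness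

/-- Dominated convergence; it turns information on continuous test functions into information on
integrals over closed sets. -/
theorem tendsto_integral_thickenedIndicator {X F : Type*} [PseudoEMetricSpace X]
    [MeasurableSpace X] [OpensMeasurableSpace X] [NormedAddCommGroup F] [NormedSpace ℝ F]
    {μ : Measure X} {f : X → F} (hf : Integrable f μ) {K : Set X} (hK : IsClosed K)
    {δ : ℕ → ℝ} (δpos : ∀ n, 0 < δ n) (δlim : Tendsto δ atTop (𝓝 0)) :
    Tendsto (fun n => ∫ x, (thickenedIndicator (δpos n) K x : ℝ) • f x ∂μ) atTop
      (𝓝 (∫ x in K, f x ∂μ)) := by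
  rw [← integral_indicator hK.measurableSet]
  refine tendsto_integral_of_dominated_convergence (fun x => ‖f x‖) (fun n => ?_) hf.norm
    (fun n => Eventually.of_forall fun x => ?_) (Eventually.of_forall fun x => ?_)
  · refine AEStronglyMeasurable.smul (Continuous.aestronglyMeasurable ?_) hf.1
    exact NNReal.continuous_coe.comp (thickenedIndicator (δpos n) K).continuous
  · rw [norm_smul, Real.norm_eq_abs, NNReal.abs_eq]
    refine mul_le_of_le_one_left (norm_nonneg _) ?_
    exact_mod_cast thickenedIndicator_le_one (δpos n) K x
  · have h := tendsto_pi_nhds.1 (thickenedIndicator_tendsto_indicator_closure δpos δlim K) x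
    rw [hK.closure_eq] at h
    have h2 := ((NNReal.continuous_coe.tendsto _).comp h).smul_const (f x)
    convert! h2 using 2
    by_cases hx : x ∈ K <;> simp [hx]

variable {T : ℝ} [hT : Fact (0 < T)]

open AddCircle

/-- Integration against an integrable function, as a functional on continuous functions. -/
def integralAgainst {f : AddCircle T → ℂ} (hf : Integrable f haarAddCircle) :
    C(AddCircle T, ℂ) →L[ℂ] ℂ :=
  LinearMap.mkContinuous
    { toFun := fun g => ∫ x, g x * f x ∂haarAddCircle
      map_add' := fun g₁ g₂ => by
        simp_rw [ContinuousMap.add_apply, add_mul]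
        exact integral_add (hf.bdd_mul g₁.continuous.aestronglyMeasurable
          (Eventually.of_forall g₁.norm_coe_le_norm)) (hf.bdd_mul
          g₂.continuous.aestronglyMeasurable (Eventually.of_forall g₂.norm_coe_le_norm))
      map_smul' := fun c g => by
        simp_rw [ContinuousMap.smul_apply, smul_eq_mul, mul_assoc, RingHom.id_apply]
        exact integral_const_mul _ _ }
    (∫ x, ‖f x‖ ∂haarAddCircle) fun g => by
      change ‖∫ x, g x * f x ∂haarAddCircle‖ ≤ _
      rw [mul_comm, ← integral_const_mul]
      refine norm_integral_le_of_norm_le (hf.norm.const_mul _) (Eventually.of_forall fun x => ?_)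
      rw [norm_mul]
      gcongr
      exact g.norm_coe_le_norm x

theorem integralAgainst_apply {f : AddCircle T → ℂ} (hf : Integrable f haarAddCircle)
    (g : C(AddCircle T, ℂ)) : integralAgainst hf g = ∫ x, g x * f x ∂haarAddCircle := rfl

theorem dense_span_fourier : Dense (Submodule.span ℂ (Set.range (fourier (T := T))) :
    Set C(AddCircle T, ℂ)) :=
  Submodule.dense_iff_topologicalClosure_eq_top.2 span_fourier_closure_eq_top

/-- Integration against `f` kills trigonometric polynomials, hence by uniform density all continuous
functions, hence in the limit indicators of compact sets. Square integrability is not available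
here. -/
theorem ae_eq_zero_of_fourierCoeff_eq_zero {f : AddCircle T → ℂ}
    (hf : Integrable f haarAddCircle) (h : ∀ n, fourierCoeff f n = 0) :
    f =ᵐ[haarAddCircle] 0 := by
  have h1 : integralAgainst hf = 0 := by
    refine ContinuousLinearMap.ext_on dense_span_fourier ?_
    rintro _ ⟨n, rfl⟩
    have := h (-n)
    rw [fourierCoeff, neg_neg] at this
    exact this
  refine ae_eq_zero_of_forall_setIntegral_isCompact_eq_zero' hf.locallyIntegrable fun K hK => ?_
  have h2 := tendsto_integral_thickenedIndicator hf hK.isClosed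
    (fun n => Nat.one_div_pos_of_nat (α := ℝ) (n := n)) tendsto_one_div_add_atTop_nhds_zero_nat
  refine tendsto_nhds_unique h2 (tendsto_const_nhds.congr fun n => ?_)
  have h3 := congrArg (fun L => L (⟨fun x => ((thickenedIndicator
    (Nat.one_div_pos_of_nat (α := ℝ) (n := n)) K x : ℝ) : ℂ), by fun_prop⟩ :
    C(AddCircle T, ℂ))) h1
  simp only [integralAgainst_apply, ContinuousMap.coe_mk, _root_.zero_apply] at h3
  rw [← h3]
  exact integral_congr_ae (Eventually.of_forall fun x => by simp)

/-- Uniform density extends the inequality from trigonometric polynomials to all continuous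
functions. Thus `h` has nonnegative integral over every compact set, and inner regularity excludes a
set of positive measure where `h < 0`. -/
theorem ae_nonneg_of_integral_norm_sq_mul_nonneg {h : AddCircle T → ℝ}
    (hh : Integrable h haarAddCircle)
    (hp : ∀ p ∈ Submodule.span ℂ (Set.range (fourier (T := T))),
      0 ≤ ∫ x, ‖p x‖ ^ 2 * h x ∂haarAddCircle) :
    0 ≤ᵐ[haarAddCircle] h := by
  have hhc : Integrable (fun x => (h x : ℂ)) haarAddCircle := hh.ofReal
  have hLr : ∀ g : C(AddCircle T, ℂ),
      (integralAgainst hhc (star g * g)).re = ∫ x, ‖g x‖ ^ 2 * h x ∂haarAddCircle := by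
    intro g
    have : integralAgainst hhc (star g * g)
        = ((∫ x, ‖g x‖ ^ 2 * h x ∂haarAddCircle : ℝ) : ℂ) := by
      rw [integralAgainst_apply, ← integral_complex_ofReal]
      refine integral_congr_ae (Eventually.of_forall fun x => ?_)
      simp [Complex.conj_mul']
    rw [this, Complex.ofReal_re]
  have hcont : ∀ g : C(AddCircle T, ℂ), 0 ≤ (integralAgainst hhc (star g * g)).re := by
    intro g
    refine dense_span_fourier.induction
      (P := fun g => 0 ≤ (integralAgainst hhc (star g * g)).re) ?_ ?_ g
    · intro p hp'
      rw [hLr]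
      exact hp p hp'
    · exact isClosed_le continuous_const (Complex.continuous_re.comp
        ((integralAgainst hhc).continuous.comp (continuous_star.mul continuous_id)))
  have hK : ∀ K : Set (AddCircle T), IsCompact K → 0 ≤ ∫ x in K, h x ∂haarAddCircle := by
    intro K hK
    have h2 := tendsto_integral_thickenedIndicator hh hK.isClosed
      (fun n => Nat.one_div_pos_of_nat (α := ℝ) (n := n)) tendsto_one_div_add_atTop_nhds_zero_nat
    refine ge_of_tendsto' h2 fun n => ?_
    -- The square root is chosen so that `|g|²` is the thickened indicator itself.
    have h3 := hcont ⟨fun x => ((√(thickenedIndicator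
      (Nat.one_div_pos_of_nat (α := ℝ) (n := n)) K x : ℝ) : ℝ) : ℂ), by fun_prop⟩
    rw [hLr] at h3
    refine h3.trans_eq (integral_congr_ae (Eventually.of_forall fun x => ?_))
    simp
  obtain ⟨g, hgm, hg⟩ := hh.1
  have hgi := hh.congr hg
  have hN : haarAddCircle {x | g x < 0} = 0 := by
    by_contra hne
    obtain ⟨K, hKs, hKc, hKp⟩ := (hgm.measurableSet_lt
      stronglyMeasurable_const).exists_lt_isCompact (pos_iff_ne_zero.2 hne)
    have h0 : 0 ≤ ∫ x in K, g x ∂haarAddCircle := by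
      rw [← setIntegral_congr_ae hKc.measurableSet (hg.mono fun x hx _ => hx)]
      exact hK K hKc
    have h1 : ∫ x in K, -g x ∂haarAddCircle = 0 := by
      refine le_antisymm ?_ ?_
      · rw [integral_neg]; linarith
      · exact setIntegral_nonneg hKc.measurableSet fun x hx => by
          have := hKs hx
          simp only [Set.mem_ofPred_eq] at this
          linarith
    rw [setIntegral_eq_zero_iff_of_nonneg_ae (f := fun x => -g x)
      ((ae_restrict_mem hKc.measurableSet).mono fun x hx => by
        have := hKs hx
        simp only [Set.mem_ofPred_eq] at this
        exact (neg_pos.2 this).le) (Integrable.neg hgi).integrableOn] at h1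
    have h2 : ∀ᵐ x ∂haarAddCircle.restrict K, False := by
      filter_upwards [h1, ae_restrict_mem hKc.measurableSet] with x hx hxK
      have := hKs hxK
      simp only [Set.mem_ofPred_eq] at this
      simp only [Pi.zero_apply, neg_eq_zero] at hx
      linarith
    rw [eventually_false_iff_eq_bot, ae_eq_bot, Measure.restrict_eq_zero] at h2
    exact hKp.ne' h2
  have hg0 : ∀ᵐ x ∂haarAddCircle, ¬ g x < 0 := by
    rw [ae_iff]; simpa using hN
  filter_upwards [hg, hg0] with x hx hx0
  rw [hx]
  exact not_lt.1 hx0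

/-- Riesz–Fischer produces an `L²` function with the same coefficients, and uniqueness in `L¹`
identifies it with `f`. -/
theorem memLp_two_of_summable_fourierCoeff {f : AddCircle T → ℂ}
    (hf : Integrable f haarAddCircle) (h : Summable fun n => ‖fourierCoeff f n‖ ^ 2) :
    MemLp f 2 haarAddCircle := by
  have hm : Memℓp (fourierCoeff f) 2 := by
    rw [memℓp_gen_iff (by norm_num)]
    simpa using h
  let g : Lp ℂ 2 (haarAddCircle (T := T)) := fourierBasis.repr.symm ⟨_, hm⟩
  have hg : ∀ n, fourierCoeff g n = fourierCoeff f n := by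
    intro n
    rw [← fourierBasis_repr, LinearIsometryEquiv.apply_symm_apply]
  have hgi : Integrable g haarAddCircle := (Lp.memLp g).integrable (by norm_num)
  have h0 := ae_eq_zero_of_fourierCoeff_eq_zero (hf.sub hgi) fun n => by
    rw [fourierCoeff]
    have e1 : Integrable (fun t => fourier (-n) t • f t) haarAddCircle := hf.fourier_smul _
    have e2 : Integrable (fun t => fourier (-n) t • g t) haarAddCircle := hgi.fourier_smul _
    simp_rw [Pi.sub_apply, smul_sub]
    rw [integral_sub e1 e2]
    exact sub_eq_zero.2 (hg n).symm
  refine (memLp_congr_ae ?_).1 (Lp.memLp g)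
  filter_upwards [h0] with x hx
  exact (sub_eq_zero.1 hx).symm

theorem hasSum_sq_fourierCoeff_of_memLp {f : AddCircle T → ℂ} (hf : MemLp f 2 haarAddCircle) :
    HasSum (fun n => ‖fourierCoeff f n‖ ^ 2) (∫ x, ‖f x‖ ^ 2 ∂haarAddCircle) := by
  have h := hasSum_sq_fourierCoeff (hf.toLp f)
  have e : ∫ x, ‖hf.toLp f x‖ ^ 2 ∂haarAddCircle = ∫ x, ‖f x‖ ^ 2 ∂haarAddCircle := by
    refine integral_congr_ae ?_
    filter_upwards [hf.coeFn_toLp] with x hx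
    rw [hx]
  rw [e] at h
  simpa only [fourierCoeff_congr_ae hf.coeFn_toLp] using h

/-- The closed span of a stationary sequence with spectral density `w`: the frame inequalities on
finite linear combinations hold if and only if `w` takes its values in `{0} ∪ [A, B]`. -/
theorem stationary_frame_iff {H : Type*} [NormedAddCommGroup H] [InnerProductSpace ℂ H]
    {w : AddCircle T → ℝ} (hw : Integrable w haarAddCircle) (hw0 : 0 ≤ᵐ[haarAddCircle] w)
    {v : ℤ → H}
    (hv : ∀ k m, inner ℂ (v k) (v m) = fourierCoeff (fun x => (w x : ℂ)) (k - m)) (A B : ℝ) :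
    (∀ c : ℤ →₀ ℂ, Summable (fun k => ‖inner ℂ (v k) (Finsupp.linearCombination ℂ v c)‖ ^ 2) ∧
      A * ‖Finsupp.linearCombination ℂ v c‖ ^ 2
        ≤ ∑' k, ‖inner ℂ (v k) (Finsupp.linearCombination ℂ v c)‖ ^ 2 ∧
      ∑' k, ‖inner ℂ (v k) (Finsupp.linearCombination ℂ v c)‖ ^ 2
        ≤ B * ‖Finsupp.linearCombination ℂ v c‖ ^ 2) ↔
    ∀ᵐ x ∂haarAddCircle, 0 < w x → A ≤ w x ∧ w x ≤ B := by
  have hwc : Integrable (fun x => (w x : ℂ)) haarAddCircle := hw.ofReal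
  have bdd : ∀ (g : C(AddCircle T, ℂ)) {f : AddCircle T → ℂ}, Integrable f haarAddCircle →
      Integrable (fun x => g x * f x) haarAddCircle := fun g f hf =>
    hf.bdd_mul g.continuous.aestronglyMeasurable (Eventually.of_forall g.norm_coe_le_norm)
  let p : (ℤ →₀ ℂ) → C(AddCircle T, ℂ) := Finsupp.linearCombination ℂ fourier
  have hpa : ∀ c x, p c x = c.sum fun m a => a * fourier m x := by
    intro c x
    simp [p, Finsupp.linearCombination_apply, Finsupp.sum]
  -- The combination with coefficients `c` is modelled by the polynomial `p c`; pairing it with `v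
  -- k` reads off a Fourier coefficient of `p c · w`.
  have coef : ∀ c k, inner ℂ (v k) (Finsupp.linearCombination ℂ v c)
      = fourierCoeff (fun x => p c x * (w x : ℂ)) k := by
    intro c k
    rw [Finsupp.linearCombination_apply, Finsupp.sum, inner_sum, fourierCoeff]
    have e : ∀ x, fourier (-k) x • (p c x * (w x : ℂ))
        = ∑ m ∈ c.support, c m * (fourier (-(k - m)) x * (w x : ℂ)) := by
      intro x
      rw [hpa, Finsupp.sum, Finset.sum_mul, smul_eq_mul, Finset.mul_sum]
      refine Finset.sum_congr rfl fun m _ => ?_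
      rw [neg_sub, sub_eq_neg_add, fourier_add]
      ring
    simp_rw [e]
    rw [integral_finsetSum _ fun m _ => (bdd _ hwc).const_mul _]
    refine Finset.sum_congr rfl fun m _ => ?_
    rw [inner_smul_right, hv, fourierCoeff, integral_const_mul]
    rfl
  have normsq : ∀ c, ‖Finsupp.linearCombination ℂ v c‖ ^ 2
      = ∫ x, ‖p c x‖ ^ 2 * w x ∂haarAddCircle := by
    intro c
    have h1 : inner ℂ (Finsupp.linearCombination ℂ v c) (Finsupp.linearCombination ℂ v c)
        = ((∫ x, ‖p c x‖ ^ 2 * w x ∂haarAddCircle : ℝ) : ℂ) := by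
      nth_rewrite 1 [Finsupp.linearCombination_apply]
      rw [Finsupp.sum, sum_inner, ← integral_complex_ofReal]
      have e : ∀ x, ((‖p c x‖ ^ 2 * w x : ℝ) : ℂ)
          = ∑ k ∈ c.support, starRingEnd ℂ (c k) * (fourier (-k) x * (p c x * (w x : ℂ))) := by
        intro x
        push_cast
        rw [← Complex.conj_mul', mul_assoc]
        nth_rewrite 1 [hpa]
        rw [Finsupp.sum, map_sum, Finset.sum_mul]
        refine Finset.sum_congr rfl fun k _ => ?_
        rw [map_mul, fourier_neg]
        ring
      simp_rw [e]
      rw [integral_finsetSum _ fun k _ => (bdd _ (bdd _ hwc)).const_mul _]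
      refine Finset.sum_congr rfl fun k _ => ?_
      rw [inner_smul_left, coef, fourierCoeff, integral_const_mul]
      rfl
    rw [← @inner_self_eq_norm_sq ℂ, h1]
    exact Complex.ofReal_re _
  have hint : ∀ c, Integrable (fun x => ‖p c x‖ ^ 2 * w x) haarAddCircle := by
    intro c
    refine hw.bdd_mul (c := ‖p c‖ ^ 2) (by fun_prop) (Eventually.of_forall fun x => ?_)
    rw [norm_pow, norm_norm]
    gcongr
    exact (p c).norm_coe_le_norm x
  have hsq : ∀ c x, ‖p c x * (w x : ℂ)‖ ^ 2 = ‖p c x‖ ^ 2 * w x ^ 2 := by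
    intro c x
    rw [norm_mul, mul_pow, Complex.norm_real, Real.norm_eq_abs, sq_abs]
  have memp : MemLp (fun x => (w x : ℂ)) 2 haarAddCircle → ∀ c,
      MemLp (fun x => p c x * (w x : ℂ)) 2 haarAddCircle := by
    intro h c
    refine MemLp.of_le_mul (c := ‖p c‖) h
      ((p c).continuous.aestronglyMeasurable.mul h.1) (Eventually.of_forall fun x => ?_)
    rw [norm_mul]
    gcongr
    exact (p c).norm_coe_le_norm x
  have hint2 : MemLp (fun x => (w x : ℂ)) 2 haarAddCircle → ∀ c,
      Integrable (fun x => ‖p c x‖ ^ 2 * w x ^ 2) haarAddCircle := by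
    intro h c
    refine ((memp h c).integrable_norm_pow two_ne_zero).congr (Eventually.of_forall fun x => ?_)
    exact hsq c x
  have frameSum : MemLp (fun x => (w x : ℂ)) 2 haarAddCircle → ∀ c,
      HasSum (fun k => ‖inner ℂ (v k) (Finsupp.linearCombination ℂ v c)‖ ^ 2)
        (∫ x, ‖p c x‖ ^ 2 * w x ^ 2 ∂haarAddCircle) := by
    intro h c
    simp_rw [coef, ← hsq]
    exact hasSum_sq_fourierCoeff_of_memLp (memp h c)
  constructor
  · intro hf
    -- The frame sum of the single vector `v 0` is `∑ |ŵ(k)|²`, so its convergence puts the a priori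
    -- only integrable `w` in `L²`.
    have hw2 : MemLp (fun x => (w x : ℂ)) 2 haarAddCircle := by
      refine memLp_two_of_summable_fourierCoeff hwc ?_
      have h := (hf (Finsupp.single 0 1)).1
      simpa [hv] using h
    have lower : ∀ᵐ x ∂haarAddCircle, 0 ≤ w x ^ 2 - A * w x := by
      refine ae_nonneg_of_integral_norm_sq_mul_nonneg ?_ fun q hq => ?_
      · have h := hint2 hw2 (Finsupp.single 0 1)
        refine Integrable.sub (h.congr (Eventually.of_forall fun x => ?_)) (hw.const_mul A)
        simp [p]
      · obtain ⟨c, rfl⟩ := (Finsupp.mem_span_range_iff_exists_finsupp).1 hq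
        have h := (hf c).2.1
        rw [(frameSum hw2 c).tsum_eq, normsq, ← integral_const_mul, ← sub_nonneg,
          ← integral_sub (hint2 hw2 c) ((hint c).const_mul A)] at h
        refine h.trans_eq (integral_congr_ae (Eventually.of_forall fun x => ?_))
        simp only [p, Finsupp.linearCombination_apply]
        ring
    have upper : ∀ᵐ x ∂haarAddCircle, 0 ≤ B * w x - w x ^ 2 := by
      refine ae_nonneg_of_integral_norm_sq_mul_nonneg ?_ fun q hq => ?_
      · have h := hint2 hw2 (Finsupp.single 0 1)
        refine Integrable.sub (hw.const_mul B) (h.congr (Eventually.of_forall fun x => ?_))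
        simp [p]
      · obtain ⟨c, rfl⟩ := (Finsupp.mem_span_range_iff_exists_finsupp).1 hq
        have h := (hf c).2.2
        rw [(frameSum hw2 c).tsum_eq, normsq, ← integral_const_mul, ← sub_nonneg,
          ← integral_sub ((hint c).const_mul B) (hint2 hw2 c)] at h
        refine h.trans_eq (integral_congr_ae (Eventually.of_forall fun x => ?_))
        simp only [p, Finsupp.linearCombination_apply]
        ring
    filter_upwards [lower, upper] with x h1 h2 hpos
    constructor <;> nlinarith
  · intro hAB c
    have hw2 : MemLp (fun x => (w x : ℂ)) 2 haarAddCircle := by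
      -- Where `w` vanishes nothing is known about `B`, which may be negative, hence the maximum
      -- with `0`.
      refine MemLp.of_bound hwc.1 (max B 0) ?_
      filter_upwards [hAB, hw0] with x h1 h2
      rw [Complex.norm_real, Real.norm_of_nonneg h2]
      rcases (show 0 ≤ w x from h2).eq_or_lt with h | h
      · rw [← h]; exact le_max_right _ _
      · exact (h1 h).2.trans (le_max_left _ _)
    refine ⟨(frameSum hw2 c).summable, ?_, ?_⟩
    · rw [(frameSum hw2 c).tsum_eq, normsq, ← integral_const_mul]
      refine integral_mono_ae ((hint c).const_mul A) (hint2 hw2 c) ?_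
      filter_upwards [hAB, hw0] with x h1 h2
      rcases (show 0 ≤ w x from h2).eq_or_lt with h | h
      · simp [← h]
      · have := mul_le_mul_of_nonneg_left (h1 h).1 (mul_nonneg (sq_nonneg ‖p c x‖) h.le)
        nlinarith
    · rw [(frameSum hw2 c).tsum_eq, normsq, ← integral_const_mul]
      refine integral_mono_ae (hint2 hw2 c) ((hint c).const_mul B) ?_
      filter_upwards [hAB, hw0] with x h1 h2
      rcases (show 0 ≤ w x from h2).eq_or_lt with h | h
      · simp [← h]
      · have := mul_le_mul_of_nonneg_left (h1 h).2 (mul_nonneg (sq_nonneg ‖p c x‖) h.le)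
        nlinarith

end FourierUniqueness

/-! ### Reducing frame inequalities to dense subspaces and orthogonal subfamilies. -/

section FrameReduction

variable {H : Type*} [NormedAddCommGroup H] [InnerProductSpace ℂ H]

/-- The frame inequalities for the family `v` at the vector `φ`. -/
def FrameBoundsAt {ι : Type*} (v : ι → H) (A B : ℝ) (φ : H) : Prop :=
  Summable (fun i => ‖inner ℂ (v i) φ‖ ^ 2) ∧
    A * ‖φ‖ ^ 2 ≤ ∑' i, ‖inner ℂ (v i) φ‖ ^ 2 ∧
    ∑' i, ‖inner ℂ (v i) φ‖ ^ 2 ≤ B * ‖φ‖ ^ 2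

/-- The frame inequalities extend from a subspace to its closure. -/
theorem FrameBoundsAt.topologicalClosure {ι : Type*} {v : ι → H} {A B : ℝ} (hB : 0 ≤ B)
    {V : Submodule ℂ H} (h : ∀ φ ∈ V, FrameBoundsAt v A B φ) :
    ∀ φ ∈ V.topologicalClosure, FrameBoundsAt v A B φ := by
  -- Finite partial sums are continuous in `φ`, so the upper bound and summability pass to the
  -- closure. The lower bound does not follow this way and uses `S` below.
  have fin : ∀ φ ∈ V.topologicalClosure, ∀ s : Finset ι,
      ∑ i ∈ s, ‖inner ℂ (v i) φ‖ ^ 2 ≤ B * ‖φ‖ ^ 2 := by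
    intro φ hφ s
    refine closure_minimal (s := (V : Set H))
      (t := {φ | ∑ i ∈ s, ‖inner ℂ (v i) φ‖ ^ 2 ≤ B * ‖φ‖ ^ 2}) ?_ ?_ hφ
    · intro χ hχ
      exact ((h χ hχ).1.sum_le_tsum s fun i _ => by positivity).trans (h χ hχ).2.2
    · exact isClosed_le (by fun_prop) (by fun_prop)
  have summ : ∀ φ ∈ V.topologicalClosure, Summable (fun i => ‖inner ℂ (v i) φ‖ ^ 2) :=
    fun φ hφ => summable_of_sum_le (fun i => by positivity) (fin φ hφ)
  have bessel : ∀ φ ∈ V.topologicalClosure, ∑' i, ‖inner ℂ (v i) φ‖ ^ 2 ≤ B * ‖φ‖ ^ 2 :=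
    fun φ hφ => (summ φ hφ).tsum_le_of_sum_le (fin φ hφ)
  have mem : ∀ φ ∈ V.topologicalClosure, Memℓp (fun i => inner ℂ (v i) φ) 2 := by
    intro φ hφ
    rw [memℓp_gen_iff (by norm_num)]
    simpa using summ φ hφ
  -- The analysis operator into `ℓ²`; the upper bound makes it continuous, so the full frame sum `‖S
  -- φ‖²` is continuous on the closure.
  let S : V.topologicalClosure →ₗ[ℂ] lp (fun _ : ι => ℂ) 2 :=
    { toFun := fun φ => ⟨fun i => inner ℂ (v i) φ.1, mem φ.1 φ.2⟩
      map_add' := fun φ χ => by ext i; exact inner_add_right _ _ _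
      map_smul' := fun c φ => by ext i; exact inner_smul_right _ _ _ }
  have hS : ∀ φ, ‖S φ‖ ^ 2 = ∑' i, ‖inner ℂ (v i) φ.1‖ ^ 2 := by
    intro φ
    have := lp.norm_rpow_eq_tsum (p := 2) (by norm_num) (S φ)
    simp only [ENNReal.toReal_ofNat, Real.rpow_ofNat] at this
    exact this
  have hScont : Continuous S := by
    refine AddMonoidHomClass.continuous_of_bound S (√B) fun φ => ?_
    refine le_of_sq_le_sq ?_ (by positivity)
    rw [hS, mul_pow, Real.sq_sqrt hB]
    exact bessel φ.1 φ.2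
  intro φ hφ
  refine ⟨summ φ hφ, ?_, bessel φ hφ⟩
  obtain ⟨φn, hn, hlim⟩ := mem_closure_iff_seq_limit.1 hφ
  have hn' : ∀ n, φn n ∈ V.topologicalClosure := fun n => V.le_topologicalClosure (hn n)
  have hlim' : Tendsto (fun n => (⟨φn n, hn' n⟩ : V.topologicalClosure)) atTop (𝓝 ⟨φ, hφ⟩) :=
    tendsto_subtype_rng.2 hlim
  have l1 := ((hScont.tendsto _).comp hlim').norm.pow 2
  rw [hS] at l1
  refine le_of_tendsto_of_tendsto' ((hlim.norm.pow 2).const_mul A) l1 fun n => ?_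
  rw [Function.comp_apply, hS]
  exact (h _ (hn n)).2.1

variable {G : Type*} {v : G → ℤ → H}

theorem inner_linearCombination_eq_zero {x : H} {u : ℤ → H} (h : ∀ k, inner ℂ x (u k) = 0)
    (c : ℤ →₀ ℂ) : inner ℂ x (Finsupp.linearCombination ℂ u c) = 0 := by
  rw [Finsupp.linearCombination_apply, Finsupp.sum, inner_sum]
  exact Finset.sum_eq_zero fun k _ => by rw [inner_smul_right, h, mul_zero]

/-- A family which splits into mutually orthogonal subfamilies satisfies the frame inequalities if
and only if each subfamily does. -/
theorem frameBoundsAt_orthogonal_iff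
    (horth : ∀ g g', g ≠ g' → ∀ k k', inner ℂ (v g k) (v g' k') = 0) (A B : ℝ) :
    (∀ φ ∈ Submodule.span ℂ (Set.range fun x : G × ℤ => v x.1 x.2),
      FrameBoundsAt (fun x : G × ℤ => v x.1 x.2) A B φ) ↔
    ∀ g, ∀ c : ℤ →₀ ℂ, FrameBoundsAt (v g) A B (Finsupp.linearCombination ℂ (v g) c) := by
  classical
  have hinj : ∀ g : G, Function.Injective fun k : ℤ => (g, k) := fun g k k' h => by
    simpa using h
  have hz : ∀ g g', g ≠ g' → ∀ k c,
      inner ℂ (v g k) (Finsupp.linearCombination ℂ (v g') c) = 0 := fun g g' hg k c =>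
    inner_linearCombination_eq_zero (horth g g' hg k) c
  constructor
  · intro h g c
    have hmem : Finsupp.linearCombination ℂ (v g) c
        ∈ Submodule.span ℂ (Set.range fun x : G × ℤ => v x.1 x.2) := by
      rw [Finsupp.linearCombination_apply, Finsupp.sum]
      exact Submodule.sum_mem _ fun k _ =>
        Submodule.smul_mem _ _ (Submodule.subset_span ⟨(g, k), rfl⟩)
    obtain ⟨h1, h2, h3⟩ := h _ hmem
    have h0 := fun g' (hg : g' ≠ g) k => hz g' g hg k c
    generalize Finsupp.linearCombination ℂ (v g) c = φ at *
    have hsupp : Function.support (fun x : G × ℤ => ‖inner ℂ (v x.1 x.2) φ‖ ^ 2)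
        ⊆ Set.range fun k : ℤ => (g, k) := by
      rintro ⟨g', k⟩ hx
      by_cases hg : g' = g
      · exact ⟨k, by rw [hg]⟩
      · exact absurd (by simp [h0 g' hg]) hx
    have e := (hinj g).tsum_eq hsupp
    have s1 := h1.comp_injective (hinj g)
    simp only [Function.comp_def] at s1
    exact ⟨s1, h2.trans_eq e.symm, e.trans_le h3⟩
  · intro h φ hφ
    obtain ⟨c, rfl⟩ := Finsupp.mem_span_range_iff_exists_finsupp.1 hφ
    -- The component of the vector in the subfamily indexed by `g`. Orthogonality makes `v g k` see
    -- only `u g`, so both the squared norm and the frame sum split over `g`.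
    set u : G → H := fun g => Finsupp.linearCombination ℂ (v g) (c.curry g) with hu
    set s := c.curry.support
    have hsum : (c.sum fun x a => a • v x.1 x.2) = ∑ g ∈ s, u g := by
      exact (Finsupp.sum_curry_index c (fun g k a => a • v g k)).symm
    rw [hsum]
    have hu0 : ∀ g ∉ s, u g = 0 := by
      intro g hg
      simp [hu, Finsupp.notMem_support_iff.1 hg]
    have huu : ∀ g g', g ≠ g' → inner ℂ (u g) (u g') = 0 := by
      intro g g' hg
      refine inner_linearCombination_eq_zero (fun k => ?_) _
      rw [← inner_conj_symm, hz g' g hg.symm, map_zero]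
    have hnorm : ‖∑ g ∈ s, u g‖ ^ 2 = ∑ g ∈ s, ‖u g‖ ^ 2 := by
      rw [← @inner_self_eq_norm_sq ℂ, sum_inner, map_sum]
      refine Finset.sum_congr rfl fun g hg => ?_
      rw [inner_sum, Finset.sum_eq_single g (fun g' _ hg' => huu g g' hg'.symm)
        (fun h => absurd hg h), inner_self_eq_norm_sq]
    have hin : ∀ g k, inner ℂ (v g k) (∑ g' ∈ s, u g') = inner ℂ (v g k) (u g) := by
      intro g k
      rw [inner_sum]
      by_cases hg : g ∈ s
      · exact Finset.sum_eq_single g (fun g' _ hg' => hz g g' hg'.symm k _)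
          (fun h => absurd hg h)
      · rw [hu0 g hg, inner_zero_right]
        exact Finset.sum_eq_zero fun g' hg' => hz g g' (by rintro rfl; exact hg hg') k _
    have hF : HasSum (fun x : G × ℤ => ‖inner ℂ (v x.1 x.2) (∑ g' ∈ s, u g')‖ ^ 2)
        (∑ g ∈ s, ∑' k, ‖inner ℂ (v g k) (u g)‖ ^ 2) := by
      have h1 : ∀ g ∈ s, HasSum (fun x : G × ℤ => ‖inner ℂ (v x.1 x.2) (u g)‖ ^ 2)
          (∑' k, ‖inner ℂ (v g k) (u g)‖ ^ 2) := by
        intro g _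
        refine ((hinj g).hasSum_iff ?_).1 (h g (c.curry g)).1.hasSum
        rintro ⟨g', k⟩ hx
        have hg : g' ≠ g := by
          rintro rfl; exact hx ⟨k, rfl⟩
        simp [hu, hz g' g hg]
      convert! hasSum_sum h1 using 1
      funext x
      rw [hin]
      by_cases hg : x.1 ∈ s
      · rw [Finset.sum_eq_single x.1 (fun g' _ hg' => by simp [hu, hz x.1 g' hg'.symm])
          (fun h => absurd hg h)]
      · rw [hu0 _ hg, Finset.sum_eq_zero fun g' hg' => ?_]
        · simp
        · rw [hz x.1 g' (by rintro rfl; exact hg hg')]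
          simp
    refine ⟨hF.summable, ?_, ?_⟩
    · rw [hF.tsum_eq, hnorm, Finset.mul_sum]
      exact Finset.sum_le_sum fun g _ => (h g (c.curry g)).2.1
    · rw [hF.tsum_eq, hnorm, Finset.mul_sum]
      exact Finset.sum_le_sum fun g _ => (h g (c.curry g)).2.2

end FrameReduction

/-! ### Left translations and the action of the centre. -/

section LeftTranslation

variable {d : ℕ}

theorem coeFn_leftTranslation (g : Heis d) (f : L2Heis d) :
    leftTranslation g f =ᵐ[volume] fun x => f (g⁻¹ * x) :=
  Lp.coeFn_compMeasurePreserving f (Heis.measurePreserving_mul_left g⁻¹)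

theorem leftTranslation_mul (g h : Heis d) (f : L2Heis d) :
    leftTranslation (g * h) f = leftTranslation g (leftTranslation h f) := by
  apply Lp.ext
  filter_upwards [coeFn_leftTranslation (g * h) f, coeFn_leftTranslation g (leftTranslation h f),
    (Heis.measurePreserving_mul_left g⁻¹).quasiMeasurePreserving.ae (coeFn_leftTranslation h f)]
    with x h1 h2 h3
  rw [h1, h2, h3, mul_inv_rev, mul_assoc]

theorem inner_leftTranslation_leftTranslation (g h : Heis d) (f f' : L2Heis d) :
    inner ℂ (leftTranslation g f) (leftTranslation h f')
      = inner ℂ (leftTranslation (h⁻¹ * g) f) f' := by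
  rw [← (leftTranslation h).inner_map_map (leftTranslation (h⁻¹ * g) f), ← leftTranslation_mul,
    mul_inv_cancel_left]

theorem integrable_leftTranslation {f : L2Heis d} (hf : Integrable f) (g : Heis d) :
    Integrable (leftTranslation g f) :=
  (integrable_congr (coeFn_leftTranslation g f)).2
    ((Heis.measurePreserving_mul_left g⁻¹).integrable_comp_of_integrable hf)

/-- The central element `(0, 0, s)` of the Heisenberg group. -/
def Heis.central (s : ℝ) : Heis d := Heis.mk 0 0 s

theorem schroedinger_central_mul (l s : ℝ) (x : Heis d) (f : L2Euc d) :
    schroedinger l (Heis.central s * x) f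
      = Complex.exp (((2 * Real.pi * l * s : ℝ) : ℂ) * Complex.I) • schroedinger l x f := by
  rw [schroedinger_apply, schroedinger_apply, smul_smul, ← Complex.exp_add, ← add_mul]
  simp only [Heis.central, Heis.mul_def, Heis.mk_p, Heis.mk_q, Heis.mk_t, zero_add,
    inner_zero_left, add_zero]
  congr 3
  push_cast
  ring

/-- The substitution `x ↦ (0, 0, s) x` preserves the measure and multiplies `Π_l` by a scalar, since
central elements act by scalars. -/
theorem fourierL1_central {f : L2Heis d} (hf : Integrable f) (s l : ℝ)
    (hfs : Integrable (leftTranslation (Heis.central s) f)) :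
    fourierL1 hfs l
      = Complex.exp (((2 * Real.pi * l * s : ℝ) : ℂ) * Complex.I) • fourierL1 hf l := by
  ext1 h
  rw [_root_.smul_apply, fourierL1_apply, fourierL1_apply, ← integral_smul]
  have mp := Heis.measurePreserving_mul_left (d := d) (Heis.central s)
  have hi := integrable_smul_schroedinger hfs l h
  have h1 := integral_map mp.aemeasurable (by rw [mp.map_eq]; exact hi.1)
  rw [mp.map_eq] at h1
  rw [h1]
  refine integral_congr_ae ?_
  filter_upwards [mp.quasiMeasurePreserving.ae (coeFn_leftTranslation (Heis.central s) f)]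
    with x hx
  rw [hx, inv_mul_cancel_left, schroedinger_central_mul, smul_comm]

end LeftTranslation

section UnimodularMultiplication

variable {α : Type*} {m : MeasurableSpace α} {μ : Measure α}

theorem memLp_unimodular_mul {u : α → ℂ} (hu : AEStronglyMeasurable u μ) (h1 : ∀ x, ‖u x‖ = 1)
    (f : Lp ℂ 2 μ) : MemLp (fun x => u x * f x) 2 μ :=
  (Lp.memLp f).of_le (hu.mul (Lp.memLp f).1)
    (Eventually.of_forall fun x => by rw [norm_mul, h1, one_mul])

/-- Multiplication by `u` is isometric, so the identity is a closed condition on `x`. It carries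
relations from `L¹ ∩ L²` to `L²`. -/
theorem unimodular_mul_of_dense {X : Type*} [TopologicalSpace X] [FrechetUrysohnSpace X]
    {u : α → ℂ} (hu : AEStronglyMeasurable u μ) (h1 : ∀ x, ‖u x‖ = 1) {S T : X → Lp ℂ 2 μ}
    (hS : Continuous S) (hT : Continuous T) {D : Set X} (hD : Dense D)
    (h : ∀ x ∈ D, S x =ᵐ[μ] fun z => u z * T x z) (x : X) :
    S x =ᵐ[μ] fun z => u z * T x z := by
  obtain ⟨xn, hn, hlim⟩ := mem_closure_iff_seq_limit.1 (hD x)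
  have l1 := (Lp.tendsto_Lp_iff_tendsto_eLpNorm' _ _).1 ((hS.tendsto x).comp hlim)
  have l2 := (Lp.tendsto_Lp_iff_tendsto_eLpNorm' _ _).1 ((hT.tendsto x).comp hlim)
  have l12 := l1.add l2
  rw [add_zero] at l12
  have hm := (memLp_unimodular_mul hu h1 (T x)).1
  have h4 : eLpNorm (⇑(S x) - fun z => u z * T x z) 2 μ = 0 := by
    refine le_antisymm (ge_of_tendsto' l12 fun n => ?_) bot_le
    have e : (⇑(S x) - fun z => u z * T x z)
        =ᵐ[μ] (⇑(S x) - ⇑(S (xn n))) + fun z => u z * (T (xn n) z - T x z) := by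
      filter_upwards [h (xn n) (hn n)] with z hz
      simp only [Pi.sub_apply, Pi.add_apply, hz]
      ring
    rw [eLpNorm_congr_ae e]
    refine (eLpNorm_add_le ((Lp.aestronglyMeasurable _).sub (Lp.aestronglyMeasurable _))
      (hu.mul ((Lp.aestronglyMeasurable _).sub (Lp.aestronglyMeasurable _)))
      (by norm_num)).trans ?_
    rw [eLpNorm_sub_comm]
    refine add_le_add le_rfl (le_of_eq (eLpNorm_congr_norm_ae (Eventually.of_forall fun z => ?_)))
    rw [Pi.mul_apply, norm_mul, h1, one_mul]
    rfl
  rw [eLpNorm_eq_zero_iff ((Lp.aestronglyMeasurable _).sub hm) (by norm_num)] at h4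
  filter_upwards [h4] with z hz using sub_eq_zero.1 hz

end UnimodularMultiplication

/-! ### The bracket summand before periodization. -/

section Bracket

variable {d : ℕ}

theorem fourierCoef_central (s : ℝ) (f : L2Heis d) :
    fourierCoef d (leftTranslation (Heis.central s) f) =ᵐ[hsMeasure d] fun z =>
      Complex.exp (((2 * Real.pi * z.1 * s : ℝ) : ℂ) * Complex.I) * fourierCoef d f z := by
  have hu : AEStronglyMeasurable (fun z : ℝ × HSIndex d =>
      Complex.exp (((2 * Real.pi * z.1 * s : ℝ) : ℂ) * Complex.I)) (hsMeasure d) := by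
    have hc : Continuous fun l : ℝ => Complex.exp (((2 * Real.pi * l * s : ℝ) : ℂ) * Complex.I) := by
      fun_prop
    exact (hc.measurable.comp measurable_fst).aestronglyMeasurable
  refine unimodular_mul_of_dense hu (fun z => Complex.norm_exp_ofReal_mul_I _)
    (S := fun f => fourierCoef d (leftTranslation (Heis.central s) f)) (T := fun f => fourierCoef d f)
    ((fourierCoef d).continuous.comp (leftTranslation _).continuous) (fourierCoef d).continuous
    (dense_integrableSubmodule d) (fun f hf => ?_) f
  have hf' := integrable_of_mem_integrableSubmodule hf
  have hfs := integrable_leftTranslation hf' (Heis.central s)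
  filter_upwards [coeFn_fourierCoef_of_integrable f hf', coeFn_fourierCoef_of_integrable _ hfs]
    with z h1 h2
  rw [h1, h2, hsCoef, fourierL1_central hf', _root_.smul_apply, inner_smul_right, hsCoef]
  ring

/-- The summand of the bracket. -/
def bracketDensity (φ ψ : L2Heis d) (l : ℝ) : ℂ :=
  hsInner (heisFourier φ l) (heisFourier ψ l) * ((|l| ^ d : ℝ) : ℂ)

theorem bracket_eq_tsum (φ ψ : L2Heis d) (α : ℝ) :
    bracket φ ψ α = ∑' j : ℤ, bracketDensity φ ψ (α + j) := rfl

/-- The trace sums over input vectors only; Parseval opens each term into a sum over output vectors,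
and summability over pairs permits the iterated summation. -/
theorem hasSum_inner_hsCoef {F G : ℝ → L2Euc d →L[ℂ] L2Euc d} {l : ℝ}
    (h : Summable fun k => inner ℂ (hsCoef G (l, k)) (hsCoef F (l, k))) :
    HasSum (fun k => inner ℂ (hsCoef G (l, k)) (hsCoef F (l, k)))
      (hsInner (F l) (G l) * ((|l| ^ d : ℝ) : ℂ)) := by
  have hfib : ∀ i, HasSum (fun j => inner ℂ (hsCoef G (l, (i, j))) (hsCoef F (l, (i, j))))
      (inner ℂ (G l (l2Basis d i)) (F l (l2Basis d i)) * ((|l| ^ d : ℝ) : ℂ)) := by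
    intro i
    convert! ((l2Basis d).hasSum_inner_mul_inner (G l (l2Basis d i))
      (F l (l2Basis d i))).mul_right ((|l| ^ d : ℝ) : ℂ) using 1
    funext j
    have hsq : ((|l| ^ d : ℝ) : ℂ) = ((√(|l| ^ d) : ℝ) : ℂ) * ((√(|l| ^ d) : ℝ) : ℂ) := by
      rw [← Complex.ofReal_mul, Real.mul_self_sqrt (by positivity)]
    rw [hsq, hsCoef, hsCoef, RCLike.inner_apply, map_mul, Complex.conj_ofReal, inner_conj_symm]
    ring
  have h2 := h.hasSum.prod_fiberwise hfib
  have h3 := h2.tsum_eq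
  rw [tsum_mul_right] at h3
  rw [hsInner, h3]
  exact h.hasSum

theorem integrable_inner_fourierCoef (φ ψ : L2Heis d) :
    Integrable (fun z => inner ℂ (fourierCoef d ψ z) (fourierCoef d φ z)) (hsMeasure d) :=
  L2.integrable_inner _ _

theorem ae_hasSum_bracketDensity (φ ψ : L2Heis d) :
    ∀ᵐ l : ℝ, HasSum (fun k => inner ℂ (fourierCoef d ψ (l, k)) (fourierCoef d φ (l, k)))
      (bracketDensity φ ψ l) := by
  filter_upwards [ae_summable_of_integrable_prod_count (integrable_inner_fourierCoef φ ψ),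
    ae_prod_count_iff.1 (hsCoef_heisFourier φ), ae_prod_count_iff.1 (hsCoef_heisFourier ψ)]
    with l h1 h2 h3
  simp_rw [← h2, ← h3] at h1 ⊢
  exact hasSum_inner_hsCoef h1

theorem integrable_bracketDensity (φ ψ : L2Heis d) : Integrable (bracketDensity φ ψ) := by
  refine (integrable_tsum_of_integrable_prod_count (integrable_inner_fourierCoef φ ψ)).congr ?_
  filter_upwards [ae_hasSum_bracketDensity φ ψ] with l hl using hl.tsum_eq

theorem integral_bracketDensity (φ ψ : L2Heis d) :
    ∫ l, bracketDensity φ ψ l = inner ℂ ψ φ := by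
  rw [← (fourierCoef d).inner_map_map, L2.inner_def,
    ← integral_tsum_of_integrable_prod_count (integrable_inner_fourierCoef φ ψ)]
  refine integral_congr_ae ?_
  filter_upwards [ae_hasSum_bracketDensity φ ψ] with l hl using hl.tsum_eq.symm

/-- The phase is conjugated because the bracket is conjugate-linear in its second argument. -/
theorem bracketDensity_central (s : ℝ) (φ ψ : L2Heis d) :
    bracketDensity φ (leftTranslation (Heis.central s) ψ) =ᵐ[volume] fun l =>
      Complex.exp (((-(2 * Real.pi * l * s) : ℝ) : ℂ) * Complex.I) * bracketDensity φ ψ l := by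
  filter_upwards [ae_hasSum_bracketDensity φ ψ, ae_prod_count_iff.1 (fourierCoef_central s ψ),
    ae_hasSum_bracketDensity φ (leftTranslation (Heis.central s) ψ)] with l h1 h2 h3
  simp_rw [h2] at h3
  refine h3.unique ?_
  convert! h1.mul_left (Complex.exp (((-(2 * Real.pi * l * s) : ℝ) : ℂ) * Complex.I)) using 1
  funext k
  rw [← smul_eq_mul (Complex.exp _), inner_smul_left, ← Complex.exp_conj, map_mul,
    Complex.conj_ofReal, Complex.conj_I]
  congr 2
  push_cast
  ring

/-- The density is the squared norm of the coefficients. Its last clause later forces brackets with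
`ψ` to vanish off `E_ψ`. -/
theorem bracketDensity_self (ψ : L2Heis d) :
    ∀ᵐ l : ℝ, ∃ r : ℝ, 0 ≤ r ∧ bracketDensity ψ ψ l = r ∧
      (r = 0 → ∀ k, fourierCoef d ψ (l, k) = 0) := by
  filter_upwards [ae_hasSum_bracketDensity ψ ψ] with l hl
  have e : ∀ k, inner ℂ (fourierCoef d ψ (l, k)) (fourierCoef d ψ (l, k))
      = ((‖fourierCoef d ψ (l, k)‖ ^ 2 : ℝ) : ℂ) := fun k => by
    rw [inner_self_eq_norm_sq_to_K]
    norm_cast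
  simp_rw [e] at hl
  have hs : Summable fun k => ‖fourierCoef d ψ (l, k)‖ ^ 2 := Complex.summable_ofReal.1 hl.summable
  refine ⟨∑' k, ‖fourierCoef d ψ (l, k)‖ ^ 2, tsum_nonneg fun k => by positivity, ?_, fun h k => ?_⟩
  · exact hl.unique (Complex.hasSum_ofReal.2 hs.hasSum)
  · have := (hasSum_zero_iff_of_nonneg (fun k => by positivity)).1 (h ▸ hs.hasSum)
    simpa using congrFun this k

end Bracket

/-! ### Folding the line onto `(0, 1]`, and onto the circle. -/

section Periodization

theorem integrable_periodization {h : ℝ → ℂ} (hh : Integrable h) :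
    Integrable (fun z : ℝ × ℤ => h (z.1 + z.2))
      ((volume.restrict (Set.Ioc (0 : ℝ) 1)).prod Measure.count) := by
  have hs : ∀ j : ℤ, Integrable (fun α : ℝ => h (α + j)) := fun j => hh.comp_add_right _
  rw [integrable_prod_iff' (aestronglyMeasurable_prod_count fun j =>
    (hs j).integrableOn.aemeasurable)]
  refine ⟨Eventually.of_forall fun j => (hs j).integrableOn, ?_⟩
  rw [integrable_count_iff]
  refine hh.norm.hasSum_intervalIntegral_comp_add_int.summable.norm.congr fun j => ?_
  rw [intervalIntegral.integral_of_le zero_le_one]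

theorem integral_periodization {h : ℝ → ℂ} (hh : Integrable h) :
    ∫ α in Set.Ioc (0 : ℝ) 1, ∑' j : ℤ, h (α + j) = ∫ l, h l := by
  have hi := integrable_periodization hh
  rw [integral_tsum_of_integrable_prod_count hi, integral_prod_symm _ hi, integral_count_eq_tsum,
    ← hh.hasSum_intervalIntegral_comp_add_int.tsum_eq]
  · refine tsum_congr fun j => ?_
    rw [intervalIntegral.integral_of_le zero_le_one]
  · exact (integrable_count_iff.1 hi.integral_prod_right).of_norm

theorem ae_all_int_translates {P : ℝ → Prop} (h : ∀ᵐ l : ℝ, P l) :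
    ∀ᵐ α : ℝ, ∀ j : ℤ, P (α + j) :=
  ae_all_iff.2 fun j => (measurePreserving_add_right volume (j : ℝ)).quasiMeasurePreserving.ae h

theorem ae_haarAddCircle_liftIoc_iff {E : Type*} {f : ℝ → E} {P : E → Prop} :
    (∀ᵐ x ∂(AddCircle.haarAddCircle (T := 1)), P (AddCircle.liftIoc 1 0 f x)) ↔
      ∀ᵐ α ∂volume.restrict (Set.Ioc (0 : ℝ) 1), P (f α) := by
  -- The circumference is 1, so normalized Haar measure is Lebesgue measure and no constants appear.
  have hv : (AddCircle.haarAddCircle (T := 1)) = volume := by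
    rw [AddCircle.volume_eq_smul_haarAddCircle, ENNReal.ofReal_one, one_smul]
  rw [hv]
  constructor
  · intro h
    have h1 := (AddCircle.measurePreserving_mk 1 0).quasiMeasurePreserving.ae h
    rw [zero_add] at h1
    filter_upwards [h1, ae_restrict_mem measurableSet_Ioc] with α h2 h3
    rwa [AddCircle.liftIoc_coe_apply (by simpa using h3)] at h2
  · intro h
    have mp := (measurePreserving_subtype_coe (μa := (volume : Measure ℝ))
      (measurableSet_Ioc (a := (0 : ℝ)) (b := 0 + 1))).comp
      (AddCircle.measurePreserving_equivIoc 1 (a := 0))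
    have h1 : ∀ᵐ α ∂volume.restrict (Set.Ioc (0 : ℝ) (0 + 1)), P (f α) := by
      rwa [zero_add]
    filter_upwards [mp.quasiMeasurePreserving.ae h1] with x hx
    exact hx

end Periodization

/-! ### Central translates as Fourier coefficients of the bracket. -/

section CircleBracket

variable {d : ℕ}

/-- The bracket, as a function on the circle `ℝ / ℤ`. -/
def circleBracket (φ ψ : L2Heis d) : AddCircle (1 : ℝ) → ℂ := AddCircle.liftIoc 1 0 (bracket φ ψ)

theorem integrable_circleBracket (φ ψ : L2Heis d) :
    Integrable (circleBracket φ ψ) AddCircle.haarAddCircle := by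
  have h := integrable_tsum_of_integrable_prod_count
    (integrable_periodization (integrable_bracketDensity φ ψ))
  have h1 : MemLp (bracket φ ψ) 1 (volume.restrict (Set.Ioc (0 : ℝ) (0 + 1))) := by
    rw [zero_add]
    exact memLp_one_iff_integrable.2 h
  exact memLp_one_iff_integrable.1 h1.memLp_liftIoc.haarAddCircle

/-- Since `k` is an integer the phase does not see `j`, so it factors out of the sum defining the
bracket. -/
theorem exp_int_translate (α : ℝ) (j k : ℤ) :
    Complex.exp (((-(2 * Real.pi * (α + j) * k) : ℝ) : ℂ) * Complex.I)
      = fourier (-k) (α : AddCircle (1 : ℝ)) := by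
  have h : (α : AddCircle (1 : ℝ)) = ((α + j : ℝ) : AddCircle (1 : ℝ)) := by
    rw [AddCircle.coe_add]
    have : ((j : ℝ) : AddCircle (1 : ℝ)) = 0 := by
      rw [AddCircle.coe_eq_zero_iff]
      exact ⟨j, by simp⟩
    rw [this, add_zero]
  rw [h, fourier_coe_apply]
  congr 1
  push_cast
  ring

/-- Plancherel writes the inner product as an integral over the line; folding that integral leaves
the bracket times a character of the circle. -/
theorem fourierCoeff_circleBracket (φ ψ : L2Heis d) (k : ℤ) :
    fourierCoeff (circleBracket φ ψ) k = inner ℂ (leftTranslation (Heis.central k) ψ) φ := by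
  rw [fourierCoeff_eq_intervalIntegral _ _ 0, ← integral_bracketDensity,
    ← integral_periodization (integrable_bracketDensity _ _),
    intervalIntegral.integral_of_le (by norm_num), zero_add, div_one, one_smul]
  refine setIntegral_congr_ae measurableSet_Ioc ?_
  filter_upwards [ae_all_int_translates (bracketDensity_central (k : ℝ) φ ψ)] with α h1 h2
  simp_rw [h1, exp_int_translate]
  rw [tsum_mul_left, circleBracket, AddCircle.liftIoc_coe_apply (by simpa using h2),
    bracket_eq_tsum, smul_eq_mul]

theorem ae_bracket_self (ψ : L2Heis d) :
    ∀ᵐ α ∂volume.restrict (Set.Ioc (0 : ℝ) 1), 0 ≤ (bracket ψ ψ α).re ∧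
      ((bracket ψ ψ α).re : ℂ) = bracket ψ ψ α ∧
      ((bracket ψ ψ α).re = 0 → ∀ (j : ℤ) (k), fourierCoef d ψ (α + j, k) = 0) := by
  filter_upwards [ae_summable_of_integrable_prod_count
    (integrable_periodization (integrable_bracketDensity ψ ψ)),
    ae_restrict_of_ae (ae_all_int_translates (bracketDensity_self ψ))] with α hs hα
  choose r h0 h1 h2 using hα
  simp only [h1] at hs
  have hs' : Summable r := Complex.summable_ofReal.1 hs
  have hb : bracket ψ ψ α = ((∑' j, r j : ℝ) : ℂ) := by
    rw [bracket_eq_tsum, Complex.ofReal_tsum]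
    exact tsum_congr h1
  rw [hb, Complex.ofReal_re]
  refine ⟨tsum_nonneg h0, rfl, fun hz j k => h2 j ?_ k⟩
  exact congrFun ((hasSum_zero_iff_of_nonneg h0).1 (hz ▸ hs'.hasSum)) j

/-- If `[φ, φ](α) = 0`, every coefficient of `𝓕φ` vanishes along `α + ℤ`. This allows the
orthogonality hypothesis to be imposed on `E_ψ` only. -/
theorem ae_bracket_eq_zero (φ ψ : L2Heis d) :
    ∀ᵐ α ∂volume.restrict (Set.Ioc (0 : ℝ) 1), (bracket φ φ α).re = 0 → bracket φ ψ α = 0 := by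
  filter_upwards [ae_bracket_self φ,
    ae_restrict_of_ae (ae_all_int_translates (ae_hasSum_bracketDensity φ ψ))] with α h1 h2 h0
  rw [bracket_eq_tsum]
  refine (tsum_congr fun j => ?_).trans tsum_zero
  refine (h2 j).unique ?_
  simp only [h1.2.2 h0 j, inner_zero_right]
  exact hasSum_zero

theorem ae_bracket_eq_zero_of_support {φ ψ : L2Heis d}
    (h : ∀ᵐ α : ℝ, α ∈ bracketSupport φ → bracket φ ψ α = 0) :
    ∀ᵐ α ∂volume.restrict (Set.Ioc (0 : ℝ) 1), bracket φ ψ α = 0 := by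
  filter_upwards [ae_bracket_eq_zero φ ψ, ae_bracket_self φ, ae_restrict_of_ae h,
    ae_restrict_mem measurableSet_Ioc] with α h1 h2 h3 h4
  rcases h2.1.eq_or_lt with h5 | h5
  · exact h1 h5.symm
  · exact h3 ⟨h4, h5⟩

theorem inner_leftTranslation_central_eq_zero {φ ψ : L2Heis d}
    (h : ∀ᵐ α : ℝ, α ∈ bracketSupport φ → bracket φ ψ α = 0) (k : ℤ) :
    inner ℂ (leftTranslation (Heis.central k) ψ) φ = 0 := by
  have h1 : circleBracket φ ψ =ᵐ[AddCircle.haarAddCircle] 0 :=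
    (ae_haarAddCircle_liftIoc_iff (P := fun z : ℂ => z = 0)).2 (ae_bracket_eq_zero_of_support h)
  rw [← fourierCoeff_circleBracket, fourierCoeff_congr_ae h1]
  simp [fourierCoeff]

theorem Heis.central_inv_mul (s r : ℝ) :
    (Heis.central s)⁻¹ * Heis.central r = (Heis.central (r - s) : Heis d) := by
  apply Heis.ext' <;> simp [Heis.central, Heis.mul_def, Heis.inv_def]
  ring

/-- The frame property of a family of central translates, conjugated by a group element, in terms
of the bracket. -/
theorem central_frame_iff (ψ : L2Heis d) (g : Heis d) (A B : ℝ) :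
    (∀ c : ℤ →₀ ℂ, FrameBoundsAt (fun k : ℤ => leftTranslation (g * Heis.central k) ψ) A B
      (Finsupp.linearCombination ℂ (fun k : ℤ => leftTranslation (g * Heis.central k) ψ) c)) ↔
    ∀ᵐ α : ℝ, α ∈ bracketSupport ψ → A ≤ (bracket ψ ψ α).re ∧ (bracket ψ ψ α).re ≤ B := by
  have hreal : ∀ᵐ x ∂AddCircle.haarAddCircle,
      0 ≤ (circleBracket ψ ψ x).re ∧ ((circleBracket ψ ψ x).re : ℂ) = circleBracket ψ ψ x :=
    (ae_haarAddCircle_liftIoc_iff (P := fun z : ℂ => 0 ≤ z.re ∧ (z.re : ℂ) = z)).2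
      ((ae_bracket_self ψ).mono fun α h => ⟨h.1, h.2.1⟩)
  refine (stationary_frame_iff (w := fun x => (circleBracket ψ ψ x).re)
    (integrable_circleBracket ψ ψ).re (hreal.mono fun x h => h.1) (fun k m => ?_) A B).trans ?_
  -- Translation by `g` is an isometry applied after the central translates, so the Gram matrix,
  -- hence the criterion, does not depend on `g`.
  · rw [fourierCoeff_congr_ae (hreal.mono fun x h => h.2), fourierCoeff_circleBracket,
      leftTranslation_mul, leftTranslation_mul, LinearIsometry.inner_map_map,
      inner_leftTranslation_leftTranslation, Heis.central_inv_mul]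
    push_cast
    rfl
  · refine (ae_haarAddCircle_liftIoc_iff
      (P := fun z : ℂ => 0 < z.re → A ≤ z.re ∧ z.re ≤ B)).trans ?_
    rw [ae_restrict_iff' measurableSet_Ioc]
    exact eventually_congr (Eventually.of_forall fun α => by
      simp only [bracketSupport, Set.mem_ofPred_eq, and_imp])

end CircleBracket

/-! ### Decomposing `Γ` over `Γ₁` and the centre. -/

section Lattice

variable {d : ℕ} {M N : Matrix (Fin d) (Fin d) ℝ}

theorem isFrameForClosedSpan_iff {ι H : Type*} [NormedAddCommGroup H] [InnerProductSpace ℂ H]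
    {v : ι → H} {A B : ℝ} (hB : 0 ≤ B) :
    IsFrameForClosedSpan v A B ↔
      ∀ φ ∈ Submodule.span ℂ (Set.range v), FrameBoundsAt v A B φ :=
  ⟨fun h φ hφ => h φ (Submodule.le_topologicalClosure _ hφ),
    fun h => FrameBoundsAt.topologicalClosure hB h⟩

theorem isFrameForClosedSpan_comp_equiv {ι κ H : Type*} [NormedAddCommGroup H]
    [InnerProductSpace ℂ H] {v : ι → H} (e : κ ≃ ι) {A B : ℝ} :
    IsFrameForClosedSpan (v ∘ e) A B ↔ IsFrameForClosedSpan v A B := by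
  unfold IsFrameForClosedSpan closedSpan
  rw [EquivLike.range_comp]
  refine forall₂_congr fun φ _ => ?_
  rw [← e.summable_iff, ← e.tsum_eq]
  rfl

theorem mk_zero_mul_central (p q : EuclideanSpace ℝ (Fin d)) (s : ℝ) :
    Heis.mk p q 0 * Heis.central s = Heis.mk p q s := by
  apply Heis.ext' <;> simp [Heis.central, Heis.mul_def]

theorem central_mul_mk_zero (p q : EuclideanSpace ℝ (Fin d)) (s : ℝ) :
    Heis.central s * Heis.mk p q 0 = Heis.mk p q s := by
  apply Heis.ext' <;> simp [Heis.central, Heis.mul_def]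

theorem mul_central_mem_gammaLattice (h : IsIntegerMatrix (Mᵀ * N)) {g : Heis d}
    (hg : g ∈ gammaOne M N) (k : ℤ) : g * Heis.central k ∈ gammaLattice M N h := by
  obtain ⟨m, n, rfl⟩ := hg
  exact ⟨m, n, k, mk_zero_mul_central _ _ _⟩

/-- The lattice `Γ` is parametrized by `Γ₁ × ℤ`. -/
def gammaEquiv (h : IsIntegerMatrix (Mᵀ * N)) : gammaOne M N × ℤ ≃ gammaLattice M N h :=
  Equiv.ofBijective (fun x => ⟨(x.1 : Heis d) * Heis.central x.2,
    mul_central_mem_gammaLattice h x.1.2 x.2⟩) <| by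
    constructor
    · rintro ⟨⟨_, m, n, rfl⟩, k⟩ ⟨⟨_, m', n', rfl⟩, k'⟩ he
      have he' := congrArg Subtype.val he
      simp only [mk_zero_mul_central] at he'
      have h1 : latticeVec M m = latticeVec M m' := congrArg Heis.p he'
      have h2 : latticeVec N n = latticeVec N n' := congrArg Heis.q he'
      have h3 : (k : ℝ) = k' := congrArg Heis.t he'
      simp only [h1, h2, Int.cast_injective h3]
    · rintro ⟨_, m, n, k, rfl⟩
      exact ⟨⟨⟨_, m, n, rfl⟩, k⟩, Subtype.ext (mk_zero_mul_central _ _ _)⟩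

/-- The quotient stays in `Γ`, a group because `Mᵀ N` is integral. Splitting off its integer central
coordinate leaves an element of `Γ₁`, trivial only if `g` and `g'` have the same `p` and `q`. -/
theorem exists_central_mul_gammaOne (h : IsIntegerMatrix (Mᵀ * N)) {g g' : Heis d}
    (hg : g ∈ gammaOne M N) (hg' : g' ∈ gammaOne M N) (hne : g ≠ g') (k k' : ℤ) :
    ∃ γ ∈ gammaOne M N, γ ≠ 1 ∧ ∃ n : ℤ,
      (g' * Heis.central k')⁻¹ * (g * Heis.central k) = Heis.central n * γ := by
  have hmem := (gammaLattice M N h).mul_mem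
    ((gammaLattice M N h).inv_mem (mul_central_mem_gammaLattice h hg' k'))
    (mul_central_mem_gammaLattice h hg k)
  obtain ⟨a, b, n, hab⟩ := hmem
  refine ⟨_, ⟨a, b, rfl⟩, fun h1 => hne ?_, n, by rw [hab, central_mul_mk_zero]⟩
  have hp := congrArg Heis.p hab
  have hq := congrArg Heis.q hab
  have hp1 := congrArg Heis.p h1
  have hq1 := congrArg Heis.q h1
  obtain ⟨m, n, rfl⟩ := hg
  obtain ⟨m', n', rfl⟩ := hg'
  simp only [Heis.mk_p, Heis.mk_q, Heis.one_def] at hp1 hq1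
  simp only [Heis.mul_def, Heis.inv_def, Heis.central, Heis.mk_p, Heis.mk_q, hp1, hq1,
    add_zero] at hp hq
  rw [neg_add_eq_zero] at hp hq
  rw [hp, hq]

end Lattice

end

theorem theorem1p4 {d : ℕ} (M N : GL (Fin d) ℝ)
    (hMN : IsIntegerMatrix ((M : Matrix (Fin d) (Fin d) ℝ)ᵀ * (N : Matrix (Fin d) (Fin d) ℝ)))
    (ψ : L2Heis d) (hψ : ψ ≠ 0)
    (horth : ∀ γ₁ ∈ gammaOne (M : Matrix (Fin d) (Fin d) ℝ) (N : Matrix (Fin d) (Fin d) ℝ),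
      γ₁ ≠ 1 → ∀ᵐ α : ℝ, α ∈ bracketSupport ψ → bracket ψ (leftTranslation γ₁ ψ) α = 0)
    (A B : ℝ) (hA : 0 < A) (hAB : A ≤ B) :
    IsFrameForClosedSpan
        (fun γ : gammaLattice (M : Matrix (Fin d) (Fin d) ℝ) (N : Matrix (Fin d) (Fin d) ℝ) hMN =>
          leftTranslation (γ : Heis d) ψ) A B ↔
      ∀ᵐ α : ℝ, α ∈ bracketSupport ψ →
        A ≤ (bracket ψ ψ α).re ∧ (bracket ψ ψ α).re ≤ B := by
  rw [← isFrameForClosedSpan_comp_equiv (gammaEquiv hMN),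
    isFrameForClosedSpan_iff (hA.le.trans hAB)]
  refine (frameBoundsAt_orthogonal_iff
    (v := fun (g : gammaOne (M : Matrix (Fin d) (Fin d) ℝ) (N : Matrix (Fin d) (Fin d) ℝ))
      (k : ℤ) => leftTranslation ((g : Heis d) * Heis.central k) ψ) ?_ A B).trans ?_
  · intro g g' hne k k'
    obtain ⟨γ, hγ, hγ1, n, he⟩ := exists_central_mul_gammaOne hMN g.2 g'.2
      (fun h => hne (Subtype.ext h)) k k'
    rw [inner_leftTranslation_leftTranslation, he, leftTranslation_mul]
    exact inner_leftTranslation_central_eq_zero (horth γ hγ hγ1) n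
  -- The bracket condition is the same for every `g`, so the quantifier over `Γ₁` drops out once
  -- `Γ₁` is known to be nonempty.
  · have : Nonempty (gammaOne (M : Matrix (Fin d) (Fin d) ℝ) (N : Matrix (Fin d) (Fin d) ℝ)) :=
      ⟨⟨_, 0, 0, rfl⟩⟩
    simp_rw [central_frame_iff]
    exact forall_const _
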